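/- Fix $L$ nonlinearities $\sigma_i:\mathbb{R}^{m_i}\to\mathbb{R}^{d_i}$ ($1\le i\le L$), where $\sigma_i$ is $\rho_i$-Lipschitz for the Euclidean norms and $\sigma_i(0)=0$, and reference matrices $M_i\in\mathbb{R}^{m_i\times d_{i-1}}$. Write $d=d_0$, $k=d_L$, and let $W$ be the maximum of all the dimensions $d_0,\ldots,d_L,m_1,\ldots,m_L$. For weight matrices $\mathcal{A}=(A_1,\ldots,A_L)$ with $A_i\in\mathbb{R}^{m_i\times d_{i-1}}$ let $$F_{\mathcal A}(x)=\sigma_L(A_L\sigma_{L-1}(A_{L-1}\cdots\sigma_1(A_1x)\cdots)),\qquad F_{\mathcal A}:\mathbb{R}^d\to\mathbb{R}^k .$$ Let $\|\cdot\|_\sigma$ be the spectral norm, and let $\|A\|_{2,1}$ be the sum of the Euclidean norms of the columns of $A$. For $v\in\mathbb{R}^k$ and $y\in\{1,\ldots,k\}$ let $\mathcal{M}(v,y)=v_y-\max_{j\ne y}v_j$. For $\gamma>0$ let $\ell_\gamma(r)=0$ for $r<-\gamma$, $\ell_\gamma(r)=1+r/\gamma$ for $-\gamma\le r\le 0$ and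 $\ell_\gamma(r)=1$ for $r>0$; for a sample $((x_i,y_i))_{i=1}^n$ let $\widehat{\mathcal R}_\gamma(f)=\frac1n\sum_{i=1}^n\ell_\gamma(-\mathcal{M}(f(x_i),y_i))$. The $\arg\max$ below uses an arbitrary fixed rule for breaking ties. Let a margin $\gamma>0$, a data bound $B$, spectral norm bounds $s_1,\ldots,s_L>0$, $(2,1)$ norm bounds $b_1,\ldots,b_L$, an integer $n\ge1$ and $\delta\in(0,1]$ be given, and let $(x,y),(x_1,y_1),\ldots,(x_n,y_n)$ be drawn iid from an arbitrary probability distribution on $\mathbb{R}^d\times\{1,\ldots,k\}$. Then with probability at least $1-\delta$ over $((x_i,y_i))_{i=1}^n$ the following holds: if $\sqrt{\sum_i\|x_i\|_2^2}\le B$, then every $\mathcal{A}=(A_1,\ldots,A_L)$ with $\|A_i\|_\sigma\le s_i$ and $\|A_i^\top-M_i^\top\|_{2,1}\le b_i$ for all $i$ satisfies $$\Pr\Big[\arg\max_jF_{\mathcal A}(x)_j\ne y\Big]\le\widehat{\mathcal R}_\gamma(F_{\mathcal A})+\frac8n+\frac{72B\ln(2W)\ln(n)}{\gamma n}\Big(\prod_{i=1}^Ls_i\rho_i\Big)\Big(\sum_{i=1}^L\frac{b_i^{2/3}}{s_i^{2/3}}\Big)^{3/2}+3\sqrt{\frac{\ln(1/\delta)}{2n}}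 .$$ -/

import Mathlib

open MeasureTheory
open scoped NNReal Matrix

namespace SpectralMargin

/-- Euclidean space of dimension `a`, with the `l₂` norm. -/
abbrev E (a : ℕ) : Type := EuclideanSpace ℝ (Fin a)

/-- The spectral norm of a matrix: its operator norm with respect to the `l₂` norms. -/
noncomputable def specNorm {a b : ℕ} (A : Matrix (Fin a) (Fin b) ℝ) : ℝ :=
  ‖LinearMap.toContinuousLinearMap (Matrix.toEuclideanLin A)‖

/-- The `(2,1)` matrix norm: the sum over the columns of their `l₂` norms. -/
noncomputable def norm21 {a b : ℕ} (A : Matrix (Fin a) (Fin b) ℝ) : ℝ :=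
  ∑ j, Real.sqrt (∑ i, A i j ^ 2)

/-- The network `x ↦ σ_L (A_L σ_{L-1} (A_{L-1} ⋯ σ_1 (A_1 x) ⋯))`. Layer `i` (counted from `0`)
maps `ℝ^(d i)` linearly to `ℝ^(m i)` by `A i`, then to `ℝ^(d (i+1))` by the nonlinearity `σ i`. -/
noncomputable def network {L : ℕ} {d : Fin (L + 1) → ℕ} {m : Fin L → ℕ}
    (σ : ∀ i : Fin L, E (m i) → E (d i.succ))
    (A : ∀ i : Fin L, Matrix (Fin (m i)) (Fin (d i.castSucc)) ℝ)
    (x : E (d 0)) : E (d (Fin.last L)) :=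
  Fin.induction (motive := fun l => E (d l)) x
    (fun i z => σ i (Matrix.toEuclideanLin (A i) z)) (Fin.last L)

/-- The maximal width `W`: the largest of all dimensions occurring in the network. -/
def width {L : ℕ} (d : Fin (L + 1) → ℕ) (m : Fin L → ℕ) : ℕ :=
  max (Finset.univ.sup d) (Finset.univ.sup m)

/-- The margin operator `v_y - max_{j ≠ y} v_j`. -/
noncomputable def margin {k : ℕ} (v : E k) (y : Fin k) : ℝ :=
  v y - ⨆ j : {j : Fin k // j ≠ y}, v j

/-- The ramp loss. -/
noncomputable def ramp (γ r : ℝ) : ℝ :=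
  if r < -γ then 0 else if r ≤ 0 then 1 + r / γ else 1

/-- The empirical ramp risk of `f` on the sample `S`. -/
noncomputable def empRampRisk {a k n : ℕ} (γ : ℝ) (f : E a → E k) (S : Fin n → E a × Fin k) : ℝ :=
  (n : ℝ)⁻¹ * ∑ i, ramp γ (-margin (f (S i).1) (S i).2)

/-- A classification rule `v ↦ argmax_j v_j`, with arbitrary breaking of ties. -/
def IsArgmax {k : ℕ} (am : E k → Fin k) : Prop :=
  ∀ (v : E k) (j : Fin k), v j ≤ v (am v)

/-- The probability that the predictor `f`, with the rule `am`, misclassifies `(x, y) ∼ μ`. -/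
noncomputable def errorProb {a k : ℕ} (μ : Measure (E a × Fin k)) (am : E k → Fin k)
    (f : E a → E k) : ℝ :=
  μ.real {p | am (f p.1) ≠ p.2}

end SpectralMargin

/-!
The ramp loss of the margin dominates the classification error and is `2 / γ`-Lipschitz in the
output of the network, so that a uniform law of large numbers for it suffices. McDiarmid's
inequality and symmetrisation reduce this law to the empirical Rademacher complexity, which
chaining bounds by metric entropy.

For a single layer, Maurey's sparsification covers the images `A X` of the data matrix `X`: if
`A - M` has `(2,1)` norm at most `b`, then `(A - M) X` is a convex combination of
`2 * (m * d) + 1` vertices of norm at most `b * ‖X‖`. Layers are composed by covering each layer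
over the centres of the cover of the preceding ones, and minimising the total entropy at a
prescribed total error produces the exponents `2 / 3` and `3 / 2`.
-/

namespace SpectralMargin

open scoped BigOperators

section Cover

variable {X Y : Type*} [PseudoMetricSpace X] [PseudoMetricSpace Y]

/-- `S` is covered by at most `N` closed balls of radius `ε`. The centres need not lie in `S`: in
terms of Mathlib's `Metric.externalCoveringNumber` this says that the covering number at scale `ε`
is at most `N`, but with a real radius. -/
def HasCover (S : Set X) (ε : ℝ) (N : ℕ) : Prop :=
  ∃ C : Finset X, C.card ≤ N ∧ ∀ x ∈ S, ∃ v ∈ C, dist x v ≤ ε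

theorem hasCover_singleton (x : X) : HasCover {x} 0 1 :=
  ⟨{x}, by simp, by simp⟩

theorem HasCover.mono {S S' : Set X} {ε ε' : ℝ} {N N' : ℕ} (h : HasCover S ε N) (hS : S' ⊆ S)
    (hε : ε ≤ ε') (hN : N ≤ N') : HasCover S' ε' N' := by
  obtain ⟨C, hC, hcov⟩ := h
  refine ⟨C, hC.trans hN, fun x hx => ?_⟩
  obtain ⟨v, hv, hd⟩ := hcov x (hS hx)
  exact ⟨v, hv, hd.trans hε⟩

theorem HasCover.image_lipschitz {S : Set X} {ε : ℝ} {N : ℕ} (h : HasCover S ε N) {K : ℝ≥0}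
    {f : X → Y} (hf : LipschitzWith K f) : HasCover (f '' S) (K * ε) N := by
  classical
  obtain ⟨C, hC, hcov⟩ := h
  refine ⟨C.image f, Finset.card_image_le.trans hC, ?_⟩
  rintro _ ⟨x, hx, rfl⟩
  obtain ⟨v, hv, hd⟩ := hcov x hx
  exact ⟨f v, Finset.mem_image_of_mem f hv,
    (hf.dist_le_mul x v).trans (mul_le_mul_of_nonneg_left hd K.2)⟩

end Cover

theorem sum_smul_mem_of_zero_mem {ι G : Type*} [Fintype ι] [AddCommGroup G] [Module ℝ G]
    {Z : Set G} (hZ : Convex ℝ Z) (h0 : (0 : G) ∈ Z) {w : ι → ℝ}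
    {z : ι → G} (hw : ∀ i, 0 ≤ w i) (hw1 : ∑ i, w i ≤ 1)
    (hz : ∀ i, z i ∈ Z) : ∑ i, w i • z i ∈ Z := by
  have h := hZ.sum_mem (t := Finset.univ) (w := fun p : Option ι => p.elim (1 - ∑ i, w i) w)
    (z := fun p => p.elim 0 z)
    (by rintro (_ | i) - <;> simp [hw, hw1]) (by simp [Fintype.sum_option])
    (by rintro (_ | i) - <;> simp [h0, hz])
  simpa [Fintype.sum_option] using h

section InnerProduct

variable {H : Type*} [NormedAddCommGroup H] [InnerProductSpace ℝ H]

theorem exists_mem_forall_dist_le_of_convex {Z : Set H} (hne : Z.Nonempty) (hc : IsComplete Z)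
    (hZ : Convex ℝ Z) (v : H) : ∃ w ∈ Z, ∀ u ∈ Z, dist u w ≤ dist u v := by
  obtain ⟨w, hw, hmin⟩ := exists_norm_eq_iInf_of_complete_convex hne hc hZ v
  rw [norm_eq_iInf_iff_real_inner_le_zero hZ hw] at hmin
  refine ⟨w, hw, fun u hu => ?_⟩
  have obtuse : inner ℝ (u - w) (v - w) ≤ 0 := by
    rw [real_inner_comm]
    exact hmin u hu
  have expand : ‖u - v‖ ^ 2 = ‖u - w‖ ^ 2 - 2 * inner ℝ (u - w) (v - w) + ‖v - w‖ ^ 2 := by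
    rw [← norm_sub_sq_real, sub_sub_sub_cancel_right]
  rw [dist_eq_norm, dist_eq_norm]
  exact le_of_sq_le_sq (by nlinarith [sq_nonneg ‖v - w‖]) (norm_nonneg _)

/-- Moving the centres into `Z` by the metric projection keeps them at distance `ε`. -/
theorem HasCover.image_of_mem_convex {α Y : Type*} [PseudoMetricSpace Y] {T : Set α} {x : α → H}
    {f : α → H → Y} {Z : Set H} {K : ℝ≥0} {ε η : ℝ} {N q : ℕ} (hx : HasCover (x '' T) ε N)
    (hc : IsComplete Z) (hZ : Convex ℝ Z) (hxZ : ∀ a ∈ T, x a ∈ Z)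
    (hf : ∀ a ∈ T, LipschitzWith K (f a)) (hfZ : ∀ z ∈ Z, HasCover ((fun a => f a z) '' T) η q) :
    HasCover ((fun a => f a (x a)) '' T) (K * ε + η) (N * q) := by
  classical
  obtain rfl | ⟨a₀, ha₀⟩ := T.eq_empty_or_nonempty
  · exact ⟨∅, by simp⟩
  obtain ⟨C, hC, hcov⟩ := hx
  choose P hPZ hP using exists_mem_forall_dist_le_of_convex ⟨x a₀, hxZ a₀ ha₀⟩ hc hZ
  choose D hD hDcov using fun v => hfZ (P v) (hPZ v)
  refine ⟨C.biUnion D, Finset.card_biUnion_le_card_mul _ _ _ (fun v _ => hD v) |>.trans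
    (Nat.mul_le_mul_right q hC), ?_⟩
  rintro _ ⟨a, ha, rfl⟩
  obtain ⟨v, hv, hxv⟩ := hcov (x a) ⟨a, ha, rfl⟩
  obtain ⟨u, hu, hfu⟩ := hDcov v (f a (P v)) ⟨a, ha, rfl⟩
  refine ⟨u, Finset.mem_biUnion.2 ⟨v, hv, hu⟩, ?_⟩
  calc dist (f a (x a)) u ≤ dist (f a (x a)) (f a (P v)) + dist (f a (P v)) u :=
        dist_triangle _ _ _
    _ ≤ K * dist (x a) (P v) + η := add_le_add ((hf a ha).dist_le_mul _ _) hfu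
    _ ≤ K * ε + η := by
      gcongr
      exact (hP v _ (hxZ a ha)).trans hxv

variable {κ : Type*} {W : κ → H} {β : ℝ} {U : H}

theorem exists_inner_le_of_mem_convexHull_range (hU : U ∈ convexHull ℝ (Set.range W)) (y : H) :
    ∃ p, inner ℝ y U ≤ inner ℝ y (W p) := by
  have hconv : ConvexOn ℝ (convexHull ℝ (Set.range W)) (innerₛₗ ℝ y) :=
    (innerₛₗ ℝ y).convexOn (convex_convexHull ℝ _)
  obtain ⟨_, ⟨p, rfl⟩, hp⟩ := hconv.exists_ge_of_mem_convexHull (subset_convexHull ℝ _) hU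
  exact ⟨p, hp⟩

/-- Each vertex is chosen so that the squared error grows by no more than the variance of a random
vertex with mean `U`. -/
theorem exists_norm_sub_smul_sum_sq_le (hW : ∀ p, ‖W p‖ ≤ β)
    (hU : U ∈ convexHull ℝ (Set.range W)) (a : H) (c : ℝ) (k : ℕ) :
    ∃ g : Fin k → κ, ‖a - c • ∑ t, (W (g t) - U)‖ ^ 2 ≤
      ‖a‖ ^ 2 + k * (c ^ 2 * (β ^ 2 - ‖U‖ ^ 2)) := by
  induction k with
  | zero => exact ⟨fun i => i.elim0, by simp⟩
  | succ k ih =>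
    obtain ⟨g, hg⟩ := ih
    obtain ⟨y, hy⟩ : ∃ y, y = a - c • ∑ t, (W (g t) - U) := ⟨_, rfl⟩
    obtain ⟨p, hp⟩ := exists_inner_le_of_mem_convexHull_range hU (c • y + c ^ 2 • U)
    refine ⟨Fin.cons p g, ?_⟩
    have split_first : a - c • ∑ t, (W ((Fin.cons p g : Fin (k + 1) → κ) t) - U) =
        y - c • (W p - U) := by
      rw [Fin.sum_univ_succ, hy]
      simp only [Fin.cons_zero, Fin.cons_succ, smul_add]
      abel
    have hWp : c ^ 2 * ‖W p‖ ^ 2 ≤ c ^ 2 * β ^ 2 := by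
      gcongr
      exact hW p
    simp only [inner_add_left, real_inner_smul_left, real_inner_self_eq_norm_sq,
      real_inner_comm (W p) U] at hp
    rw [split_first, norm_sub_sq_real, norm_smul, mul_pow, norm_sub_sq_real,
      real_inner_smul_right, inner_sub_right, Real.norm_eq_abs, sq_abs]
    rw [← hy] at hg
    push_cast
    linarith

/-- The sum of the chosen vertices is divided by `√k (1 + √k)` rather than by `k`: this shrinkage
improves the error `β / √k` of the plain average to `β / (1 + √k)`. -/
theorem exists_norm_sub_smul_sum_le (hW : ∀ p, ‖W p‖ ≤ β)
    (hU : U ∈ convexHull ℝ (Set.range W)) {k : ℕ} (hk : 0 < k) :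
    ∃ g : Fin k → κ, ‖U - (√k * (1 + √k))⁻¹ • ∑ t, W (g t)‖ ≤ β / (1 + √k) := by
  obtain ⟨r, hr0, hrk⟩ : ∃ r : ℝ, 0 < r ∧ r ^ 2 = k :=
    ⟨√k, by positivity, Real.sq_sqrt k.cast_nonneg⟩
  have hr : √k = r := by rw [← hrk, Real.sqrt_sq hr0.le]
  obtain ⟨g, hg⟩ := exists_norm_sub_smul_sum_sq_le hW hU ((1 + r)⁻¹ • U) (r * (1 + r))⁻¹ k
  have hβ : 0 ≤ β := (norm_nonneg _).trans (hW (g ⟨0, hk⟩))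
  have recenter : (1 + r)⁻¹ • U - (r * (1 + r))⁻¹ • ∑ t, (W (g t) - U) =
      U - (r * (1 + r))⁻¹ • ∑ t, W (g t) := by
    have hcoeff : (1 + r)⁻¹ + (r * (1 + r))⁻¹ * r ^ 2 = 1 := by field_simp
    rw [Finset.sum_sub_distrib, Finset.sum_const, Finset.card_univ, Fintype.card_fin,
      ← Nat.cast_smul_eq_nsmul ℝ, ← hrk, smul_sub, smul_smul, sub_sub_eq_add_sub, ← add_smul,
      hcoeff, one_smul]
  refine ⟨g, le_of_sq_le_sq ?_ (by positivity)⟩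
  rw [hr, ← recenter]
  refine hg.trans_eq ?_
  rw [norm_smul, Real.norm_of_nonneg (by positivity), ← hrk]
  field_simp
  ring

theorem hasCover_convexHull_range [Fintype κ] (hW : ∀ p, ‖W p‖ ≤ β) (k : ℕ) :
    HasCover (convexHull ℝ (Set.range W)) (β / (1 + √k)) (Fintype.card κ ^ k) := by
  classical
  obtain rfl | hk := k.eq_zero_or_pos
  · have hball : convexHull ℝ (Set.range W) ⊆ Metric.closedBall 0 β :=
      convexHull_min (Set.range_subset_iff.2 fun p => by simpa using hW p)
        (convex_closedBall 0 β)
    exact ⟨{0}, by simp, fun U hU => ⟨0, by simp, by simpa using hball hU⟩⟩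
  · refine ⟨Finset.univ.image fun g : Fin k → κ => (√k * (1 + √k))⁻¹ • ∑ t, W (g t),
      Finset.card_image_le.trans (by simp), fun U hU => ?_⟩
    obtain ⟨g, hg⟩ := exists_norm_sub_smul_sum_le hW hU hk
    exact ⟨_, Finset.mem_image_of_mem _ (Finset.mem_univ g), by rwa [dist_eq_norm]⟩

theorem hasCover_sum_abs_le {ι : Type*} [Fintype ι] {V : ι → H} (hV : ∀ i, ‖V i‖ ≤ 1) {β : ℝ}
    (hβ : 0 ≤ β) (k : ℕ) :
    HasCover ((fun c : ι → ℝ => ∑ i, c i • V i) '' {c | ∑ i, |c i| ≤ β}) (β / (1 + √k))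
      ((2 * Fintype.card ι + 1) ^ k) := by
  let vertex : Option (ι × Bool) → H :=
    fun p => p.elim 0 fun q => (if q.2 then β else -β) • V q.1
  have hvertex : ∀ p, ‖vertex p‖ ≤ β := by
    rintro (_ | ⟨i, _ | _⟩) <;>
      simp [vertex, hβ, norm_smul, abs_of_nonneg, mul_le_of_le_one_right, hV]
  refine (hasCover_convexHull_range hvertex k).mono ?_ le_rfl
    (Nat.pow_le_pow_left (by simp [mul_comm]) k)
  rintro _ ⟨c, hc, rfl⟩
  have hmem : ∀ p, vertex p ∈ convexHull ℝ (Set.range vertex) :=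
    fun p => subset_convexHull ℝ _ ⟨p, rfl⟩
  have hterm : ∀ i, c i • V i = (|c i| / β) • vertex (some (i, decide (0 ≤ c i))) := by
    intro i
    have hci : |c i| ≤ β :=
      (Finset.single_le_sum (fun i _ => abs_nonneg (c i)) (Finset.mem_univ i)).trans hc
    obtain rfl | hβ := hβ.eq_or_lt
    · simp [abs_nonpos_iff.1 hci]
    · rcases le_or_gt 0 (c i) with h | h
      · simp [vertex, smul_smul, h, abs_of_nonneg, hβ.ne']
      · simp [vertex, smul_smul, h.not_ge, abs_of_neg, h, hβ.ne']
  simp only [hterm]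
  refine sum_smul_mem_of_zero_mem (convex_convexHull ℝ _) (hmem none) (fun i => by positivity) ?_
    fun i => hmem _
  rw [← Finset.sum_div]
  exact div_le_one_of_le₀ hc hβ

end InnerProduct

section Batch

variable {T F G : Type*}

/-- A batch of points of `F` indexed by `T`, as one point of the `ℓ²` sum. For `F = ℝ^a` its norm is
the Frobenius norm of the data matrix. -/
abbrev Batch (T F : Type*) : Type _ := PiLp 2 fun _ : T => F

/-- The batch obtained by applying `f` to every point of a batch. -/
def mapBatch (f : F → G) (X : Batch T F) : Batch T G :=
  WithLp.toLp 2 fun t => f (X t)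

@[simp]
theorem mapBatch_apply (f : F → G) (X : Batch T F) (t : T) : mapBatch f X t = f (X t) := rfl

variable [Fintype T] [SeminormedAddCommGroup F] [SeminormedAddCommGroup G]

theorem lipschitzWith_toLp_apply {f : T → F → G} {K : ℝ≥0} (hf : ∀ t, LipschitzWith K (f t)) :
    LipschitzWith K fun X : Batch T F => (WithLp.toLp 2 fun t => f t (X t) : Batch T G) := by
  refine LipschitzWith.of_dist_le_mul fun X Y => le_of_sq_le_sq ?_ (by positivity)
  rw [dist_eq_norm, dist_eq_norm, mul_pow, PiLp.norm_sq_eq_of_L2, PiLp.norm_sq_eq_of_L2,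
    Finset.mul_sum]
  gcongr with t
  rw [← mul_pow]
  gcongr
  exact (hf t).norm_sub_le (X t) (Y t)

theorem lipschitzWith_mapBatch {f : F → G} {K : ℝ≥0} (hf : LipschitzWith K f) :
    LipschitzWith K (mapBatch (T := T) f) :=
  lipschitzWith_toLp_apply fun _ => hf

theorem norm_mapBatch_le {f : F → G} {K : ℝ≥0} (hf : LipschitzWith K f) (hf0 : f 0 = 0)
    (X : Batch T F) : ‖mapBatch f X‖ ≤ K * ‖X‖ := by
  have hmap0 : mapBatch f (0 : Batch T F) = 0 := by
    ext : 1
    exact hf0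
  simpa [hmap0] using (lipschitzWith_mapBatch hf).norm_sub_le X 0

end Batch

section Layer

variable {T : Type*} [Fintype T] {a b : ℕ}

theorem lipschitzWith_toEuclideanLin {A : Matrix (Fin a) (Fin b) ℝ} {s : ℝ≥0}
    (hA : specNorm A ≤ s) : LipschitzWith s (Matrix.toEuclideanLin A) :=
  (LinearMap.toContinuousLinearMap (Matrix.toEuclideanLin A)).lipschitz.weaken hA

theorem norm21_nonneg (A : Matrix (Fin a) (Fin b) ℝ) : 0 ≤ norm21 A :=
  Finset.sum_nonneg fun _ _ => Real.sqrt_nonneg _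

/-- The norm of the `j`-th row of the data matrix whose columns are the points of `X`. -/
noncomputable def coordNorm (X : Batch T (E b)) (j : Fin b) : ℝ :=
  √(∑ t, X t j ^ 2)

/-- The batch that carries the normalised `p.2`-th coordinate of `X` in its `p.1`-th coordinate and
vanishes elsewhere. These rank one batches span the images of `X` under matrices. -/
noncomputable def coordVertex (X : Batch T (E b)) (p : Fin a × Fin b) : Batch T (E a) :=
  WithLp.toLp 2 fun t => EuclideanSpace.single p.1 ((coordNorm X p.2)⁻¹ * X t p.2)

theorem coordNorm_sq (X : Batch T (E b)) (j : Fin b) : coordNorm X j ^ 2 = ∑ t, X t j ^ 2 :=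
  Real.sq_sqrt (Finset.sum_nonneg fun _ _ => sq_nonneg _)

theorem norm_sq_eq_sum_coordNorm_sq (X : Batch T (E b)) : ‖X‖ ^ 2 = ∑ j, coordNorm X j ^ 2 := by
  simp only [PiLp.norm_sq_eq_of_L2, Real.norm_eq_abs, sq_abs,
    coordNorm_sq]
  exact Finset.sum_comm

theorem norm_coordVertex_le_one (X : Batch T (E b)) (p : Fin a × Fin b) :
    ‖coordVertex X p‖ ≤ 1 := by
  refine le_of_sq_le_sq ?_ zero_le_one
  simp only [PiLp.norm_sq_eq_of_L2, coordVertex, PiLp.norm_single, Real.norm_eq_abs, sq_abs,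
    mul_pow]
  rw [← Finset.mul_sum, ← coordNorm_sq, inv_pow, one_pow]
  exact inv_mul_le_one

theorem coordNorm_mul_inv_mul (X : Batch T (E b)) (j : Fin b) (t : T) :
    coordNorm X j * ((coordNorm X j)⁻¹ * X t j) = X t j := by
  by_cases h : coordNorm X j = 0
  · have hsum : ∑ t, X t j ^ 2 = 0 := by rw [← coordNorm_sq, h, zero_pow two_ne_zero]
    have hXtj := (Finset.sum_eq_zero_iff_of_nonneg fun _ _ => sq_nonneg _).1 hsum t
      (Finset.mem_univ t)
    rw [sq_eq_zero_iff.1 hXtj, mul_zero, mul_zero]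
  · exact mul_inv_cancel_left₀ h _

theorem mapBatch_toEuclideanLin_eq_sum (D : Matrix (Fin a) (Fin b) ℝ) (X : Batch T (E b)) :
    mapBatch (Matrix.toEuclideanLin D) X =
      ∑ p : Fin a × Fin b, (D p.1 p.2 * coordNorm X p.2) • coordVertex X p := by
  ext t i
  simp only [mapBatch_apply, Matrix.ofLp_toLpLin, Matrix.toLin'_apply, Fintype.sum_prod_type,
    coordVertex, WithLp.ofLp_sum, Finset.sum_apply, WithLp.ofLp_smul, Pi.smul_apply, smul_eq_mul,
    Matrix.mulVec, dotProduct, PiLp.single_apply]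
  rw [Finset.sum_comm]
  refine Finset.sum_congr rfl fun j _ => ?_
  simp only [mul_ite, mul_zero, Finset.sum_ite_eq, Finset.mem_univ, if_true]
  rw [mul_assoc, coordNorm_mul_inv_mul]

theorem sum_abs_mul_coordNorm_le (D : Matrix (Fin a) (Fin b) ℝ) (X : Batch T (E b)) :
    ∑ p : Fin a × Fin b, |D p.1 p.2 * coordNorm X p.2| ≤ norm21 Dᵀ * ‖X‖ := by
  have hX : ‖X‖ = √(∑ j, coordNorm X j ^ 2) := by
    rw [← norm_sq_eq_sum_coordNorm_sq, Real.sqrt_sq (norm_nonneg X)]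
  rw [Fintype.sum_prod_type, norm21, Finset.sum_mul, hX]
  refine Finset.sum_le_sum fun i _ => ?_
  simpa only [abs_mul, sq_abs, Matrix.transpose_apply] using
    Real.sum_mul_le_sqrt_mul_sqrt Finset.univ (fun j => |D i j|) fun j => |coordNorm X j|

/-- The weight matrices admitted in a layer with reference matrix `M`. -/
def layerClass (M : Matrix (Fin a) (Fin b) ℝ) (s β : ℝ) : Set (Matrix (Fin a) (Fin b) ℝ) :=
  {A | specNorm A ≤ s ∧ norm21 (Aᵀ - Mᵀ) ≤ β}

theorem hasCover_mapBatch_layerClass (X : Batch T (E b)) (M : Matrix (Fin a) (Fin b) ℝ) (s : ℝ)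
    {β : ℝ} (hβ : 0 ≤ β) (k : ℕ) :
    HasCover ((fun A => mapBatch (Matrix.toEuclideanLin A) X) '' layerClass M s β)
      (β * ‖X‖ / (1 + √k)) ((2 * (a * b) + 1) ^ k) := by
  have hcov := (hasCover_sum_abs_le (norm_coordVertex_le_one (a := a) X)
    (mul_nonneg hβ (norm_nonneg X)) k).image_lipschitz
      (isometry_add_left (mapBatch (Matrix.toEuclideanLin M) X)).lipschitz
  refine hcov.mono ?_ (by simp) (by simp)
  rintro _ ⟨A, ⟨-, hA⟩, rfl⟩
  refine ⟨_, ⟨fun p => (A - M) p.1 p.2 * coordNorm X p.2, ?_, rfl⟩, ?_⟩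
  · exact (sum_abs_mul_coordNorm_le (A - M) X).trans
      (mul_le_mul_of_nonneg_right (by rwa [Matrix.transpose_sub]) (norm_nonneg X))
  · simp only [← mapBatch_toEuclideanLin_eq_sum]
    ext t : 1
    simp

end Layer

section Allocation

@[to_additive]
theorem partialProd_last {R : Type*} [CommMonoid R] {n : ℕ} (f : Fin n → R) :
    Fin.partialProd f (Fin.last n) = ∏ i, f i := by
  rw [Fin.partialProd, ← List.prod_ofFn, List.take_of_length_le (by simp)]

theorem exists_nat_le_one_add_sqrt (t : ℝ) : ∃ k : ℕ, t ≤ 1 + √k ∧ (k : ℝ) ≤ t ^ 2 := by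
  rcases le_total t 1 with h | h
  · exact ⟨0, by simpa using h, by simpa using sq_nonneg t⟩
  · refine ⟨⌈(t - 1) ^ 2⌉₊, ?_, ?_⟩
    · linarith [Real.le_sqrt_of_sq_le (Nat.le_ceil ((t - 1) ^ 2))]
    · nlinarith [Nat.ceil_lt_add_one (sq_nonneg (t - 1))]

/-- With `α = ∑ u i ^ 2`, allotting to index `i` a share `ε * u i ^ 2 / α` of the error leads to
`1 + √(k i) = P * u i * α / ε`, which minimises `∑ k i`. -/
theorem exists_nat_sum_cube_div_one_add_sqrt_le {ι : Type*} [Fintype ι] (u : ι → ℝ) (P : ℝ)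
    {ε : ℝ} (hε : 0 < ε) :
    ∃ k : ι → ℕ, ∑ i, (k i : ℝ) ≤ P ^ 2 * (∑ i, u i ^ 2) ^ 3 / ε ^ 2 ∧
      P * ∑ i, u i ^ 3 / (1 + √(k i)) ≤ ε := by
  set α := ∑ i, u i ^ 2 with hα
  have hα0 : 0 ≤ α := Finset.sum_nonneg fun i _ => sq_nonneg _
  choose k hkt htk using fun i => exists_nat_le_one_add_sqrt (P * u i * α / ε)
  refine ⟨k, ?_, ?_⟩
  · calc ∑ i, (k i : ℝ) ≤ ∑ i, (P * α / ε) ^ 2 * u i ^ 2 :=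
          Finset.sum_le_sum fun i _ => (htk i).trans_eq (by ring)
      _ = P ^ 2 * α ^ 3 / ε ^ 2 := by
          rw [← Finset.mul_sum, ← hα]
          ring
  · obtain h0 | hpos := hα0.eq_or_lt
    · have hu : ∀ i, u i = 0 := fun i => sq_eq_zero_iff.1 <|
        (Finset.sum_eq_zero_iff_of_nonneg fun i _ => sq_nonneg (u i)).1 h0.symm i
          (Finset.mem_univ i)
      simp [hu, hε.le]
    · calc P * ∑ i, u i ^ 3 / (1 + √(k i)) = ∑ i, P * (u i ^ 3 / (1 + √(k i))) :=
            Finset.mul_sum _ _ _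
        _ ≤ ∑ i, ε / α * u i ^ 2 := by
            refine Finset.sum_le_sum fun i _ => ?_
            have hPu : P * u i ≤ (1 + √(k i : ℝ)) * (ε / α) := by
              have := mul_le_mul_of_nonneg_right (hkt i) (div_pos hε hpos).le
              rwa [div_mul_div_cancel₀ hε.ne', mul_div_cancel_right₀ _ hpos.ne'] at this
            rw [← mul_div_assoc, div_le_iff₀ (by positivity)]
            nlinarith [mul_le_mul_of_nonneg_right hPu (sq_nonneg (u i))]
        _ = ε := by rw [← Finset.mul_sum, ← hα, div_mul_cancel₀ _ hpos.ne']

theorem exists_nat_sum_div_one_add_sqrt_le {ι : Type*} [Fintype ι] {b s : ι → ℝ}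
    (hb : ∀ i, 0 ≤ b i) (hs : ∀ i, 0 ≤ s i) (P : ℝ) {ε : ℝ} (hε : 0 < ε) :
    ∃ k : ι → ℕ, ∑ i, (k i : ℝ) ≤
        (P * (∑ i, b i ^ (2 / 3 : ℝ) / s i ^ (2 / 3 : ℝ)) ^ (3 / 2 : ℝ)) ^ 2 / ε ^ 2 ∧
      P * ∑ i, b i / s i / (1 + √(k i)) ≤ ε := by
  have hbs : ∀ i, 0 ≤ b i / s i := fun i => div_nonneg (hb i) (hs i)
  have hcube : ∀ i, ((b i / s i) ^ (1 / 3 : ℝ)) ^ 3 = b i / s i := fun i => by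
    rw [← Real.rpow_natCast, ← Real.rpow_mul (hbs i)]
    norm_num
  have hsq : ∀ i, ((b i / s i) ^ (1 / 3 : ℝ)) ^ 2 = b i ^ (2 / 3 : ℝ) / s i ^ (2 / 3 : ℝ) :=
    fun i => by
      rw [← Real.div_rpow (hb i) (hs i), ← Real.rpow_natCast, ← Real.rpow_mul (hbs i)]
      norm_num
  have hα : 0 ≤ ∑ i, b i ^ (2 / 3 : ℝ) / s i ^ (2 / 3 : ℝ) :=
    Finset.sum_nonneg fun i _ => hsq i ▸ sq_nonneg _
  have hpow : ∀ x : ℝ, 0 ≤ x → (x ^ (3 / 2 : ℝ)) ^ 2 = x ^ 3 := fun x hx => by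
    rw [← Real.rpow_natCast, ← Real.rpow_natCast, ← Real.rpow_mul hx]
    norm_num
  simpa only [hcube, hsq, mul_pow, hpow _ hα] using
    exists_nat_sum_cube_div_one_add_sqrt_le (fun i => (b i / s i) ^ (1 / 3 : ℝ)) P hε

end Allocation

section Network

variable {T : Type*} [Fintype T] {L : ℕ} {d : Fin (L + 1) → ℕ} {m : Fin L → ℕ}
  {σ : ∀ i : Fin L, E (m i) → E (d i.succ)} {ρ : Fin L → ℝ≥0}
  {A M : ∀ i : Fin L, Matrix (Fin (m i)) (Fin (d i.castSucc)) ℝ} {s : Fin L → ℝ≥0} {b : Fin L → ℝ}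

/-- The output of the first `l` layers of the network, so that `network` is the case `l = L`. -/
noncomputable def layerOutput (σ : ∀ i : Fin L, E (m i) → E (d i.succ))
    (A : ∀ i : Fin L, Matrix (Fin (m i)) (Fin (d i.castSucc)) ℝ) (l : Fin (L + 1))
    (x : E (d 0)) : E (d l) :=
  Fin.induction (motive := fun l => E (d l)) x
    (fun i z => σ i (Matrix.toEuclideanLin (A i) z)) l

theorem layerOutput_succ (i : Fin L) :
    layerOutput σ A i.succ = σ i ∘ Matrix.toEuclideanLin (A i) ∘ layerOutput σ A i.castSucc :=
  rfl

theorem layerOutput_apply_zero (hσ0 : ∀ i, σ i 0 = 0) (l : Fin (L + 1)) :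
    layerOutput σ A l 0 = 0 := by
  induction l using Fin.induction with
  | zero => rfl
  | succ i ih => simp [layerOutput_succ, ih, hσ0]

theorem lipschitzWith_layerOutput (hσ : ∀ i, LipschitzWith (ρ i) (σ i))
    (hA : ∀ i, specNorm (A i) ≤ s i) (l : Fin (L + 1)) :
    LipschitzWith (Fin.partialProd (fun i => s i * ρ i) l) (layerOutput σ A l) := by
  induction l using Fin.induction with
  | zero =>
    rw [Fin.partialProd_zero]
    exact LipschitzWith.id
  | succ i ih =>
    rw [layerOutput_succ, Fin.partialProd_succ]
    exact ((hσ i).comp ((lipschitzWith_toEuclideanLin (hA i)).comp ih)).weaken (le_of_eq (by ring))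

theorem continuous_layerOutput (hσ : ∀ i, Continuous (σ i)) (l : Fin (L + 1)) :
    Continuous fun p : (∀ i : Fin L, Matrix (Fin (m i)) (Fin (d i.castSucc)) ℝ) × E (d 0) =>
      layerOutput σ p.1 l p.2 := by
  induction l using Fin.induction with
  | zero => exact continuous_snd
  | succ i ih =>
    simp only [layerOutput_succ, Function.comp_apply, Matrix.toLpLin_apply]
    fun_prop

theorem continuous_network (hσ : ∀ i, Continuous (σ i)) :
    Continuous fun p : (∀ i : Fin L, Matrix (Fin (m i)) (Fin (d i.castSucc)) ℝ) × E (d 0) =>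
      network σ p.1 p.2 :=
  continuous_layerOutput hσ (Fin.last L)

/-- The weights admitted in a network with reference matrices `M`. -/
def weightClass (M : ∀ i : Fin L, Matrix (Fin (m i)) (Fin (d i.castSucc)) ℝ)
    (s b : Fin L → ℝ) : Set (∀ i : Fin L, Matrix (Fin (m i)) (Fin (d i.castSucc)) ℝ) :=
  {A | ∀ i, A i ∈ layerClass (M i) (s i) (b i)}

theorem hasCover_mapBatch_layerOutput (hσ : ∀ i, LipschitzWith (ρ i) (σ i))
    (hσ0 : ∀ i, σ i 0 = 0) (hs : ∀ i, 0 < s i) (hb : ∀ i, 0 ≤ b i) (X : Batch T (E (d 0)))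
    (k : Fin L → ℕ) {N : ℕ} (hN : ∀ i, 2 * (m i * d i.castSucc) + 1 ≤ N) (l : Fin (L + 1)) :
    HasCover ((fun A => mapBatch (layerOutput σ A l) X) '' weightClass M (fun i => s i) b)
      (Fin.partialProd (fun i => s i * ρ i) l * ‖X‖ *
        Fin.partialSum (fun i => b i / s i / (1 + √(k i))) l)
      (N ^ Fin.partialSum k l) := by
  induction l using Fin.induction with
  | zero =>
    exact (hasCover_singleton X).mono (by rintro _ ⟨A, -, rfl⟩; rfl) (by simp) (by simp)
  | succ i ih =>
    rw [Fin.partialProd_succ, Fin.partialSum_succ, Fin.partialSum_succ, pow_add]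
    set P := Fin.partialProd (fun i => s i * ρ i) i.castSucc
    have hlayer : ∀ Y ∈ Metric.closedBall (0 : Batch T (E (d i.castSucc))) (P * ‖X‖),
        HasCover ((fun A => mapBatch (σ i) (mapBatch (Matrix.toEuclideanLin (A i)) Y)) ''
          weightClass M (fun i => s i) b) (ρ i * (b i * (P * ‖X‖) / (1 + √(k i)))) (N ^ k i) := by
      intro Y hY
      refine ((hasCover_mapBatch_layerClass Y (M i) (s i) (hb i) (k i)).image_lipschitz
        (lipschitzWith_mapBatch (hσ i))).mono ?_ ?_ (Nat.pow_le_pow_left (hN i) _)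
      · rintro _ ⟨A, hA, rfl⟩
        exact ⟨_, ⟨A i, hA i, rfl⟩, rfl⟩
      · have := hb i
        gcongr
        simpa using hY
    refine (ih.image_of_mem_convex (K := ρ i * s i)
      (f := fun A Y => mapBatch (σ i) (mapBatch (Matrix.toEuclideanLin (A i)) Y))
      Metric.isClosed_closedBall.isComplete (convex_closedBall 0 (P * ‖X‖)) (fun A hA => ?_)
      (fun A hA => ?_) hlayer).mono ?_ (le_of_eq ?_) le_rfl
    · simpa using norm_mapBatch_le (lipschitzWith_layerOutput hσ (fun j => (hA j).1) i.castSucc)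
        (layerOutput_apply_zero hσ0 _) X
    · exact (lipschitzWith_mapBatch (hσ i)).comp
        (lipschitzWith_mapBatch (lipschitzWith_toEuclideanLin (hA i).1))
    · exact subset_rfl
    · have hsi : (s i : ℝ) ≠ 0 := (NNReal.coe_pos.2 (hs i)).ne'
      push_cast
      field_simp

/-- The dependence of the generalisation bound on the network: on the Lipschitz constants `ρ` of
the nonlinearities, the spectral norms `s` of the weights and their `(2,1)` distances `b` from the
reference matrices. -/
noncomputable def spectralComplexity (ρ : Fin L → ℝ≥0) (s b : Fin L → ℝ) : ℝ :=
  (∏ i, s i * (ρ i : ℝ)) * (∑ i, b i ^ (2 / 3 : ℝ) / s i ^ (2 / 3 : ℝ)) ^ (3 / 2 : ℝ)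

theorem spectralComplexity_nonneg {s : Fin L → ℝ} (hs : ∀ i, 0 ≤ s i) (hb : ∀ i, 0 ≤ b i) :
    0 ≤ spectralComplexity ρ s b := by
  unfold spectralComplexity
  have := fun i => div_nonneg (Real.rpow_nonneg (hb i) (2 / 3)) (Real.rpow_nonneg (hs i) (2 / 3))
  exact mul_nonneg (Finset.prod_nonneg fun i _ => mul_nonneg (hs i) (ρ i).2)
    (Real.rpow_nonneg (Finset.sum_nonneg fun i _ => this i) _)

theorem exists_hasCover_mapBatch_network (hσ : ∀ i, LipschitzWith (ρ i) (σ i))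
    (hσ0 : ∀ i, σ i 0 = 0) (hs : ∀ i, 0 < s i) (hb : ∀ i, 0 ≤ b i) (X : Batch T (E (d 0)))
    {N : ℕ} (hN : ∀ i, 2 * (m i * d i.castSucc) + 1 ≤ N) {ε : ℝ} (hε : 0 < ε) :
    ∃ K : ℕ, (K : ℝ) ≤ (‖X‖ * spectralComplexity ρ (fun i => s i) b) ^ 2 / ε ^ 2 ∧
      HasCover ((fun A => mapBatch (network σ A) X) '' weightClass M (fun i => s i) b) ε
        (N ^ K) := by
  obtain ⟨k, hk, hkε⟩ := exists_nat_sum_div_one_add_sqrt_le hb (fun i => (s i).2)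
    (‖X‖ * ∏ i, (s i : ℝ) * ρ i) hε
  refine ⟨∑ i, k i, ?_, ?_⟩
  · rw [spectralComplexity, ← mul_assoc]
    exact_mod_cast hk
  · have hcov := hasCover_mapBatch_layerOutput (M := M) hσ hσ0 hs hb X k hN (Fin.last L)
    rw [partialProd_last, partialSum_last, partialSum_last, mul_comm _ ‖X‖] at hcov
    push_cast at hcov
    exact hcov.mono subset_rfl hkε le_rfl

end Network

section Rademacher

variable {ι κ : Type*} [Fintype κ]

/-- The vector of the signs `ε`. -/
def signVector (ε : κ → ℤˣ) : EuclideanSpace ℝ κ :=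
  WithLp.toLp 2 fun i => ((ε i : ℤ) : ℝ)

theorem inner_signVector (ε : κ → ℤˣ) (x : EuclideanSpace ℝ κ) :
    inner ℝ (signVector ε) x = ∑ i, ((ε i : ℤ) : ℝ) * x i := by
  simp [PiLp.inner_apply, signVector, mul_comm]

theorem norm_signVector (ε : κ → ℤˣ) : ‖signVector ε‖ = √(Fintype.card κ) := by
  have hsq : ∀ u : ℤˣ, ((u : ℤ) : ℝ) ^ 2 = 1 := fun u => by
    rcases Int.units_eq_one_or u with rfl | rfl <;> simp
  simp [EuclideanSpace.norm_eq, signVector, hsq]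

variable [DecidableEq κ]

theorem expect_exp_inner_signVector (x : EuclideanSpace ℝ κ) :
    𝔼 ε, Real.exp (inner ℝ (signVector ε) x) = ∏ i, Real.cosh (x i) := by
  have hprod := Finset.prod_univ_sum (fun _ : κ => (Finset.univ : Finset ℤˣ))
    (fun i u => Real.exp (((u : ℤ) : ℝ) * x i))
  rw [Fintype.piFinset_univ] at hprod
  simp only [inner_signVector, Real.exp_sum, Fintype.expect_eq_sum_div_card, ← hprod,
    Real.cosh_eq, Finset.prod_div_distrib]
  simp [UnitsInt.univ]

theorem expect_exp_inner_signVector_le (x : EuclideanSpace ℝ κ) :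
    𝔼 ε, Real.exp (inner ℝ (signVector ε) x) ≤ Real.exp (‖x‖ ^ 2 / 2) := by
  rw [expect_exp_inner_signVector, EuclideanSpace.norm_sq_eq, Finset.sum_div, Real.exp_sum]
  simp only [Real.norm_eq_abs, sq_abs]
  exact Finset.prod_le_prod (fun i _ => (Real.cosh_pos _).le)
    fun i _ => Real.cosh_le_exp_half_sq (x i)

theorem expect_le_of_expect_exp_le {Ω : Type*} [Fintype Ω] [Nonempty Ω] {f : Ω → ℝ} {u : ℝ}
    (h : 𝔼 ω, Real.exp (f ω) ≤ Real.exp u) : 𝔼 ω, f ω ≤ u := by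
  have hexp : 𝔼 ω, (f ω + (1 - u)) ≤ 1 := by
    calc 𝔼 ω, (f ω + (1 - u)) ≤ 𝔼 ω, Real.exp (f ω) * Real.exp (-u) := by
          refine Finset.expect_le_expect fun ω _ => ?_
          rw [← Real.exp_add]
          linarith [Real.add_one_le_exp (f ω + -u)]
      _ ≤ Real.exp u * Real.exp (-u) := by
          rw [← Finset.expect_mul]
          gcongr
      _ = 1 := by rw [← Real.exp_add, add_neg_cancel, Real.exp_zero]
  rw [Finset.expect_add_distrib, Fintype.expect_const] at hexp
  linarith

/-- The Rademacher average of a family of vectors of `ℝ^κ`, not normalised by the dimension. -/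
noncomputable def rademacher (v : ι → EuclideanSpace ℝ κ) : ℝ :=
  𝔼 ε, ⨆ a, inner ℝ (signVector ε) (v a)

theorem bddAbove_range_inner {H : Type*} [NormedAddCommGroup H] [InnerProductSpace ℝ H]
    {f : ι → H} (hf : Bornology.IsBounded (Set.range f)) (y : H) :
    BddAbove (Set.range fun a => inner ℝ y (f a)) := by
  obtain ⟨R, hR⟩ := hf.exists_norm_le
  refine ⟨‖y‖ * R, ?_⟩
  rintro _ ⟨a, rfl⟩
  exact (real_inner_le_norm _ _).trans
    (mul_le_mul_of_nonneg_left (hR _ (Set.mem_range_self a)) (norm_nonneg _))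

variable [Nonempty ι] {v w : ι → EuclideanSpace ℝ κ} {r : ℝ}

theorem rademacher_le_sqrt_mul (hv : ∀ a, ‖v a‖ ≤ r) :
    rademacher v ≤ √(Fintype.card κ) * r := by
  refine Finset.expect_le Finset.univ_nonempty fun ε _ => ciSup_le fun a => ?_
  rw [← norm_signVector ε]
  exact (real_inner_le_norm _ _).trans (mul_le_mul_of_nonneg_left (hv a) (norm_nonneg _))

theorem rademacher_add_le (hv : Bornology.IsBounded (Set.range v))
    (hw : Bornology.IsBounded (Set.range w)) :
    rademacher (v + w) ≤ rademacher v + rademacher w := by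
  rw [rademacher, rademacher, rademacher, ← Finset.expect_add_distrib]
  refine Finset.expect_le_expect fun ε _ => ciSup_le fun a => ?_
  rw [Pi.add_apply, inner_add_right]
  exact add_le_add (le_ciSup (bddAbove_range_inner hv _) a)
    (le_ciSup (bddAbove_range_inner hw _) a)

theorem mul_rademacher_le_log_card_add {C : Finset (EuclideanSpace ℝ κ)} (hv : ∀ a, v a ∈ C)
    (hC : ∀ x ∈ C, ‖x‖ ≤ r) (c : ℝ) :
    c * rademacher v ≤ Real.log C.card + c ^ 2 * r ^ 2 / 2 := by
  have hCpos : (0 : ℝ) < C.card :=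
    Nat.cast_pos.2 (Finset.card_pos.2 ⟨_, hv (Classical.arbitrary ι)⟩)
  have hfin : (Set.range v).Finite :=
    C.finite_toSet.subset (Set.range_subset_iff.2 hv)
  rw [rademacher, Finset.mul_expect]
  refine expect_le_of_expect_exp_le ?_
  calc 𝔼 ε, Real.exp (c * ⨆ a, inner ℝ (signVector ε) (v a))
      ≤ 𝔼 ε, ∑ x ∈ C, Real.exp (inner ℝ (signVector ε) (c • x)) := by
        refine Finset.expect_le_expect fun ε _ => ?_
        obtain ⟨a, ha⟩ : (⨆ a, inner ℝ (signVector ε) (v a)) ∈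
            Set.range fun a => inner ℝ (signVector ε) (v a) :=
          (Set.range_nonempty _).csSup_mem
            (by simpa only [Set.range_comp'] using hfin.image (inner ℝ (signVector ε)))
        rw [← ha, ← real_inner_smul_right]
        exact Finset.single_le_sum (f := fun x => Real.exp (inner ℝ (signVector ε) (c • x)))
          (fun _ _ => (Real.exp_pos _).le) (hv a)
    _ = ∑ x ∈ C, 𝔼 ε, Real.exp (inner ℝ (signVector ε) (c • x)) :=
        Finset.expect_sum_comm _ _ _
    _ ≤ ∑ x ∈ C, Real.exp (c ^ 2 * r ^ 2 / 2) := by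
        refine Finset.sum_le_sum fun x hx => (expect_exp_inner_signVector_le _).trans ?_
        rw [norm_smul, mul_pow, Real.norm_eq_abs, sq_abs]
        gcongr
        exact hC x hx
    _ = Real.exp (Real.log C.card + c ^ 2 * r ^ 2 / 2) := by
        rw [Finset.sum_const, nsmul_eq_mul, Real.exp_add, Real.exp_log hCpos]

theorem rademacher_le_mul_sqrt_log_card {C : Finset (EuclideanSpace ℝ κ)} (hv : ∀ a, v a ∈ C)
    (hr : 0 ≤ r) (hC : ∀ x ∈ C, ‖x‖ ≤ r) :
    rademacher v ≤ r * √(2 * Real.log C.card) := by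
  have hdiscrim := discrim_le_zero (a := r ^ 2 / 2) (b := -rademacher v) (c := Real.log C.card)
    fun c => by linarith [mul_rademacher_le_log_card_add hv hC c]
  rw [discrim] at hdiscrim
  refine le_of_sq_le_sq ?_ (by positivity)
  rw [mul_pow, Real.sq_sqrt (by positivity)]
  linarith

/-- One link of the chain: `π` and `π'` approximate `v` at the consecutive scales `2 * δ` and
`δ`. -/
theorem rademacher_sub_le {π π' : ι → EuclideanSpace ℝ κ} {C C' : Finset (EuclideanSpace ℝ κ)}
    {q δ : ℝ} (hq : 0 ≤ q) (hδ : 0 < δ) (hπ : ∀ a, π a ∈ C) (hπ' : ∀ a, π' a ∈ C')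
    (hC : Real.log C.card ≤ q ^ 2 / (2 * δ) ^ 2) (hC' : Real.log C'.card ≤ q ^ 2 / δ ^ 2)
    (hvπ : ∀ a, dist (v a) (π a) ≤ 2 * δ) (hvπ' : ∀ a, dist (v a) (π' a) ≤ δ) :
    rademacher (π' - π) ≤ 6 * q := by
  classical
  set D := (Finset.image₂ (· - ·) C' C).filter (‖·‖ ≤ 3 * δ)
  have hmem : ∀ a, (π' - π) a ∈ D := fun a => by
    refine Finset.mem_filter.2 ⟨Finset.mem_image₂_of_mem (hπ' a) (hπ a), ?_⟩
    rw [Pi.sub_apply, ← dist_eq_norm]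
    linarith [dist_triangle_left (π' a) (π a) (v a), hvπ a, hvπ' a]
  have hD : Real.log D.card ≤ 2 * (q / δ) ^ 2 := by
    have hcard : D.card ≤ C'.card * C.card :=
      (Finset.card_filter_le _ _).trans (Finset.card_image₂_le _ _ _)
    obtain ⟨a⟩ := ‹Nonempty ι›
    have hDpos := Finset.card_pos.2 ⟨_, hmem a⟩
    have hCpos := Finset.card_pos.2 ⟨_, hπ a⟩
    have hCpos' := Finset.card_pos.2 ⟨_, hπ' a⟩
    calc Real.log D.card ≤ Real.log (C'.card * C.card) :=
          Real.log_le_log (by exact_mod_cast hDpos) (by exact_mod_cast hcard)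
      _ = Real.log C'.card + Real.log C.card := Real.log_mul (by positivity) (by positivity)
      _ ≤ q ^ 2 / δ ^ 2 + q ^ 2 / (2 * δ) ^ 2 := add_le_add hC' hC
      _ = 5 / 4 * (q / δ) ^ 2 := by
          field_simp
          ring
      _ ≤ 2 * (q / δ) ^ 2 := by nlinarith [sq_nonneg (q / δ)]
  calc rademacher (π' - π) ≤ 3 * δ * √(2 * Real.log D.card) :=
        rademacher_le_mul_sqrt_log_card hmem (by positivity) fun x hx => (Finset.mem_filter.1 hx).2
    _ ≤ 3 * δ * √((2 * (q / δ)) ^ 2) := by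
        gcongr
        linarith
    _ = 6 * q := by
        rw [Real.sqrt_sq (by positivity)]
        field_simp
        ring

theorem exists_net_rademacher_le {D q : ℝ} (hD : 0 < D) (hv : ∀ a, ‖v a‖ ≤ D) (hq : 0 ≤ q)
    (hcov : ∀ δ : ℝ, 0 < δ →
      ∃ N : ℕ, Real.log N ≤ q ^ 2 / δ ^ 2 ∧ HasCover (Set.range v) δ N) (N : ℕ) :
    ∃ (C : Finset (EuclideanSpace ℝ κ)) (π : ι → EuclideanSpace ℝ κ),
      Real.log C.card ≤ q ^ 2 / (D / 2 ^ N) ^ 2 ∧ (∀ a, π a ∈ C) ∧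
      (∀ a, dist (v a) (π a) ≤ D / 2 ^ N) ∧ rademacher π ≤ N * (6 * q) := by
  induction N with
  | zero =>
    refine ⟨{0}, fun _ => 0, ?_, by simp, by simpa using hv, by simp [rademacher]⟩
    simpa using div_nonneg (sq_nonneg q) (sq_nonneg D)
  | succ N ih =>
    obtain ⟨C, π, hC, hπ, hvπ, hrad⟩ := ih
    have hscale : D / 2 ^ N = 2 * (D / 2 ^ (N + 1)) := by
      rw [pow_succ]
      field_simp
    have hδ : 0 < D / 2 ^ (N + 1) := by positivity
    obtain ⟨N', hN', C', hC', hnear⟩ := hcov _ hδ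
    choose π' hπ' hvπ' using fun a => hnear (v a) ⟨a, rfl⟩
    have hlog : Real.log C'.card ≤ q ^ 2 / (D / 2 ^ (N + 1)) ^ 2 := by
      refine (Real.log_le_log ?_ (by exact_mod_cast hC')).trans hN'
      exact Nat.cast_pos.2 (Finset.card_pos.2 ⟨_, hπ' (Classical.arbitrary ι)⟩)
    refine ⟨C', π', hlog, hπ', hvπ', ?_⟩
    rw [hscale] at hC hvπ
    have hbdd : ∀ {C : Finset (EuclideanSpace ℝ κ)} {π : ι → EuclideanSpace ℝ κ},
        (∀ a, π a ∈ C) → Bornology.IsBounded (Set.range π) := fun h =>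
      (Finset.finite_toSet _).isBounded.subset (Set.range_subset_iff.2 h)
    have hlink := rademacher_sub_le hq hδ hπ hπ' hC hlog hvπ hvπ'
    have hadd := rademacher_add_le (v := π' - π) (w := π)
      ((hbdd hπ').sub (hbdd hπ) |>.subset (Set.range_subset_iff.2 fun a =>
        Set.sub_mem_sub ⟨a, rfl⟩ ⟨a, rfl⟩)) (hbdd hπ)
    rw [sub_add_cancel] at hadd
    push_cast
    linarith

theorem rademacher_le_of_entropy {D q : ℝ} (hD : 0 < D) (hv : ∀ a, ‖v a‖ ≤ D) (hq : 0 ≤ q)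
    (hcov : ∀ δ : ℝ, 0 < δ →
      ∃ N : ℕ, Real.log N ≤ q ^ 2 / δ ^ 2 ∧ HasCover (Set.range v) δ N) (N : ℕ) :
    rademacher v ≤ √(Fintype.card κ) * (D / 2 ^ N) + N * (6 * q) := by
  obtain ⟨C, π, -, hπ, hvπ, hrad⟩ := exists_net_rademacher_le hD hv hq hcov N
  have hrest : rademacher (v - π) ≤ √(Fintype.card κ) * (D / 2 ^ N) :=
    rademacher_le_sqrt_mul fun a => by simpa [dist_eq_norm] using hvπ a
  have hadd := rademacher_add_le (v := v - π) (w := π)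
    (isBounded_iff_forall_norm_le.2 ⟨D / 2 ^ N, by
      rintro _ ⟨a, rfl⟩
      simpa [dist_eq_norm] using hvπ a⟩)
    (C.finite_toSet.isBounded.subset (Set.range_subset_iff.2 hπ))
  rw [sub_add_cancel] at hadd
  linarith

end Rademacher

section Concentration

open ProbabilityTheory

theorem hasSubgaussianMGF_prod_add {Ω Ω' : Type*} [MeasurableSpace Ω] [MeasurableSpace Ω']
    {μ : Measure Ω} {ν : Measure Ω'} [SFinite μ] [SFinite ν] {X : Ω → ℝ} {Y : Ω × Ω' → ℝ}
    {c c' : ℝ≥0} (hX : HasSubgaussianMGF X c μ) (hYm : Measurable Y)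
    (hY : ∀ x, HasSubgaussianMGF (fun y => Y (x, y)) c' ν) :
    HasSubgaussianMGF (fun p => X p.1 + Y p) (c + c') (μ.prod ν) := by
  have hsection : ∀ t x, ∫ y, Real.exp (t * (X x + Y (x, y))) ∂ν ≤
      Real.exp (t * X x) * Real.exp (c' * t ^ 2 / 2) := fun t x => by
    simp only [mul_add, Real.exp_add, integral_const_mul]
    exact mul_le_mul_of_nonneg_left ((hY x).mgf_le t) (Real.exp_pos _).le
  have hdom : ∀ t, Integrable (fun x => Real.exp (t * X x) * Real.exp (c' * t ^ 2 / 2)) μ :=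
    fun t => (hX.integrable_exp_mul t).mul_const _
  have hmeas : ∀ t, AEStronglyMeasurable (fun p => Real.exp (t * (X p.1 + Y p))) (μ.prod ν) :=
    fun t => by
      have hX' : AEMeasurable (fun p : Ω × Ω' => X p.1) (μ.prod ν) :=
        hX.aemeasurable.comp_quasiMeasurePreserving Measure.quasiMeasurePreserving_fst
      exact (((hX'.add hYm.aemeasurable).const_mul t).exp).aestronglyMeasurable
  have hexp : ∀ t, Integrable (fun p => Real.exp (t * (X p.1 + Y p))) (μ.prod ν) := fun t => by
    refine (integrable_prod_iff (hmeas t)).2 ⟨.of_forall fun x => ?_, ?_⟩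
    · simp only [mul_add, Real.exp_add]
      exact ((hY x).integrable_exp_mul t).const_mul _
    · simp only [Real.norm_of_nonneg (Real.exp_pos _).le]
      exact (hdom t).mono' (hmeas t).integral_prod_right' (.of_forall fun x => by
        rw [Real.norm_of_nonneg (integral_nonneg fun y => (Real.exp_pos _).le)]
        exact hsection t x)
  refine ⟨hexp, fun t => ?_⟩
  calc mgf (fun p => X p.1 + Y p) (μ.prod ν) t
      = ∫ x, ∫ y, Real.exp (t * (X x + Y (x, y))) ∂ν ∂μ := integral_prod _ (hexp t)
    _ ≤ ∫ x, Real.exp (t * X x) * Real.exp (c' * t ^ 2 / 2) ∂μ :=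
        integral_mono (hexp t).integral_prod_left (hdom t) (hsection t)
    _ ≤ Real.exp (c * t ^ 2 / 2) * Real.exp (c' * t ^ 2 / 2) := by
        rw [integral_mul_const]
        exact mul_le_mul_of_nonneg_right (hX.mgf_le t) (Real.exp_pos _).le
    _ = Real.exp ((c + c' : ℝ≥0) * t ^ 2 / 2) := by
        rw [← Real.exp_add]
        push_cast
        ring_nf

theorem hasSubgaussianMGF_sub_integral_of_le_add {Ω : Type*} [MeasurableSpace Ω] {μ : Measure Ω}
    [IsProbabilityMeasure μ] {X : Ω → ℝ} (hX : AEMeasurable X μ) {c : ℝ≥0}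
    (hosc : ∀ ω ω', X ω' ≤ X ω + c) :
    HasSubgaussianMGF (fun ω => X ω - ∫ ω, X ω ∂μ) ((c / 2) ^ 2) μ := by
  obtain ⟨ω₀⟩ := μ.nonempty_of_neZero
  have hbdd : BddBelow (Set.range X) := ⟨X ω₀ - c, by
    rintro _ ⟨ω, rfl⟩
    linarith [hosc ω ω₀]⟩
  have : Nonempty Ω := ⟨ω₀⟩
  have hmem : ∀ ω, X ω ∈ Set.Icc (⨅ ω, X ω) ((⨅ ω, X ω) + c) := fun ω =>
    ⟨ciInf_le hbdd ω, sub_le_iff_le_add.1 (le_ciInf fun ω' => by linarith [hosc ω' ω])⟩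
  simpa using hasSubgaussianMGF_of_mem_Icc hX (.of_forall hmem)

theorem hasSubgaussianMGF_prod_sub_integral_of_le_add {Ω Ω' : Type*} [MeasurableSpace Ω]
    [MeasurableSpace Ω'] {μ : Measure Ω} {ν : Measure Ω'} [IsProbabilityMeasure μ]
    [IsProbabilityMeasure ν] {F : Ω × Ω' → ℝ} (hF : Measurable F)
    (hintegrable : Integrable F (μ.prod ν)) {c c' : ℝ≥0} (hosc : ∀ x x' y, F (x', y) ≤ F (x, y) + c)
    (hsection : ∀ x, HasSubgaussianMGF (fun y => F (x, y) - ∫ y, F (x, y) ∂ν) c' ν) :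
    HasSubgaussianMGF (fun p => F p - ∫ p, F p ∂μ.prod ν) ((c / 2) ^ 2 + c') (μ.prod ν) := by
  set g : Ω → ℝ := fun x => ∫ y, F (x, y) ∂ν
  have hg : Measurable g := hF.stronglyMeasurable.integral_prod_right'.measurable
  have hint_section : ∀ x, Integrable (fun y => F (x, y)) ν := fun x =>
    ((hsection x).integrable.add (integrable_const (g x))).congr
      (.of_forall fun y => sub_add_cancel _ _)
  have hg_osc : ∀ x x', g x' ≤ g x + c := fun x x' => by
    calc g x' ≤ ∫ y, (F (x, y) + c) ∂ν :=
          integral_mono (hint_section x') ((hint_section x).add (integrable_const _)) (hosc x x')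
      _ = g x + c := by
          rw [integral_add (hint_section x) (integrable_const _), integral_const]
          simp [g]
  refine (hasSubgaussianMGF_prod_add (hasSubgaussianMGF_sub_integral_of_le_add hg.aemeasurable
    hg_osc) (Y := fun p => F p - g p.1) (hF.sub (hg.comp measurable_fst)) hsection).congr
    (.of_forall fun p => ?_)
  simp [g, integral_prod F hintegrable]

theorem le_add_sum_of_update_le {κ : Type*} [Fintype κ] [DecidableEq κ] {Z : κ → Type*}
    {f : (∀ i, Z i) → ℝ} {c : κ → ℝ}
    (hf : ∀ i z w, f (Function.update z i w) ≤ f z + c i) (z z' : ∀ i, Z i) :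
    f z' ≤ f z + ∑ i, c i := by
  suffices h : ∀ s : Finset κ, f (s.piecewise z' z) ≤ f z + ∑ i ∈ s, c i by
    simpa using h Finset.univ
  intro s
  induction s using Finset.induction_on with
  | empty => simp
  | insert i s hi ih =>
    rw [Finset.piecewise_insert, Finset.sum_insert hi]
    linarith [hf i (s.piecewise z' z) (z' i)]

theorem integrable_pi_of_update_le {κ : Type*} [Fintype κ] [DecidableEq κ] {Z : κ → Type*}
    [∀ i, MeasurableSpace (Z i)] (μ : ∀ i, Measure (Z i)) [∀ i, IsProbabilityMeasure (μ i)]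
    {f : (∀ i, Z i) → ℝ} (hf : Measurable f) {c : κ → ℝ}
    (hdiff : ∀ i z w, f (Function.update z i w) ≤ f z + c i) : Integrable f (Measure.pi μ) := by
  obtain ⟨z₀⟩ := (Measure.pi μ).nonempty_of_neZero
  refine Integrable.of_mem_Icc (f z₀ - ∑ i, c i) (f z₀ + ∑ i, c i) hf.aemeasurable
    (.of_forall fun z => ⟨?_, le_add_sum_of_update_le hdiff z₀ z⟩)
  linarith [le_add_sum_of_update_le hdiff z z₀]

/-- McDiarmid's inequality, in the form of a bound on the moment generating function. The first
coordinate is split off: its contribution is controlled by Hoeffding's lemma, and that of the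
other ones, conditionally on it, by induction. -/
theorem hasSubgaussianMGF_sub_integral_of_update_le {n : ℕ} {Z : Fin n → Type*}
    [∀ i, MeasurableSpace (Z i)] (μ : ∀ i, Measure (Z i)) [∀ i, IsProbabilityMeasure (μ i)]
    {f : (∀ i, Z i) → ℝ} (hf : Measurable f) {c : Fin n → ℝ≥0}
    (hdiff : ∀ i z w, f (Function.update z i w) ≤ f z + c i) :
    HasSubgaussianMGF (fun z => f z - ∫ z, f z ∂Measure.pi μ) (∑ i, (c i / 2) ^ 2)
      (Measure.pi μ) := by
  induction n with
  | zero =>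
    have hconst : ∀ z, f z = f finZeroElim := fun z => congrArg f (Subsingleton.elim _ _)
    simp [hconst]
  | succ n ih =>
    set e := MeasurableEquiv.piFinSuccAbove Z 0
    set ν := Measure.pi fun j => μ (Fin.succAbove 0 j)
    have he : MeasurePreserving e (Measure.pi μ) ((μ 0).prod ν) :=
      measurePreserving_piFinSuccAbove μ 0
    set F : Z 0 × (∀ j, Z (Fin.succAbove 0 j)) → ℝ := fun p => f (e.symm p)
    have hF : Measurable F := hf.comp e.symm.measurable
    have htail : ∀ x j y w, F (x, Function.update y j w) ≤ F (x, y) + c (Fin.succAbove 0 j) :=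
      fun x j y w => by
        have h := hdiff (Fin.succAbove 0 j) (e.symm (x, y)) w
        rwa [show Function.update (e.symm (x, y)) _ w = e.symm (x, Function.update y j w) from
          (Fin.insertNth_update 0 x j w y).symm] at h
    have hhead : ∀ x x' y, F (x', y) ≤ F (x, y) + c 0 := fun x x' y => by
      have h := hdiff 0 (e.symm (x, y)) x'
      rwa [show Function.update (e.symm (x, y)) 0 x' = e.symm (x', y) from
        Fin.update_insertNth 0 x x' y] at h
    have hintegrable : Integrable F ((μ 0).prod ν) :=
      he.symm.integrable_comp_of_integrable (integrable_pi_of_update_le μ hf hdiff)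
    have hprod := hasSubgaussianMGF_prod_sub_integral_of_le_add hF hintegrable hhead
      fun x => ih _ (hF.comp measurable_prodMk_left) (htail x)
    have hmean : ∫ p, F p ∂(μ 0).prod ν = ∫ z, f z ∂Measure.pi μ := he.symm.integral_comp' f
    rw [hmean, ← he.map_eq] at hprod
    rw [Fin.sum_univ_succAbove _ 0]
    refine (hprod.of_map e.measurable.aemeasurable).congr (.of_forall fun z => ?_)
    simp only [F, Function.comp_apply, e.symm_apply_apply]

theorem measureReal_add_integral_le_le_of_update_le {n : ℕ} {Z : Fin n → Type*}
    [∀ i, MeasurableSpace (Z i)] (μ : ∀ i, Measure (Z i)) [∀ i, IsProbabilityMeasure (μ i)]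
    {f : (∀ i, Z i) → ℝ} (hf : Measurable f) {c : Fin n → ℝ≥0}
    (hdiff : ∀ i z w, f (Function.update z i w) ≤ f z + c i) {u : ℝ} (hu : 0 ≤ u) :
    (Measure.pi μ).real {z | ∫ z, f z ∂Measure.pi μ + u ≤ f z} ≤
      Real.exp (-(2 * u ^ 2) / ∑ i, (c i : ℝ) ^ 2) := by
  have h := (hasSubgaussianMGF_sub_integral_of_update_le μ hf hdiff).measure_ge_le hu
  simp only [le_sub_iff_add_le'] at h
  refine h.trans_eq ?_
  congr 1
  push_cast
  simp only [div_pow, ← Finset.sum_div]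
  field_simp

end Concentration

section Symmetrization

theorem abs_ciSup_le {ι : Type*} [Nonempty ι] {g : ι → ℝ} {K : ℝ} (h : ∀ a, |g a| ≤ K) :
    |⨆ a, g a| ≤ K := by
  let a : ι := Classical.arbitrary ι
  have hbdd : BddAbove (Set.range g) := ⟨K, by
    rintro _ ⟨a, rfl⟩
    exact (le_abs_self _).trans (h a)⟩
  exact abs_le.2 ⟨(neg_le_of_abs_le (h a)).trans (le_ciSup hbdd a),
    ciSup_le fun a => (le_abs_self _).trans (h a)⟩

theorem ciSup_le_ciSup_add {ι : Type*} [Nonempty ι] {g h : ι → ℝ} {K : ℝ}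
    (hbdd : BddAbove (Set.range h)) (H : ∀ a, g a ≤ h a + K) : ⨆ a, g a ≤ (⨆ a, h a) + K :=
  ciSup_le fun a => (H a).trans (add_le_add_left (le_ciSup hbdd a) K)

theorem integrable_iSup {Ω ι : Type*} [MeasurableSpace Ω] [Countable ι] [Nonempty ι]
    {ν : Measure Ω} [IsFiniteMeasure ν] {φ : ι → Ω → ℝ} {K : ℝ} (hφ : ∀ a, Measurable (φ a))
    (hK : ∀ a ω, |φ a ω| ≤ K) : Integrable (fun ω => ⨆ a, φ a ω) ν :=
  Integrable.of_bound (Measurable.iSup hφ).aestronglyMeasurable K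
    (.of_forall fun ω => abs_ciSup_le fun a => hK a ω)

variable {ι Z κ : Type*} [Fintype κ]

/-- The vector of the values of `g` on the sample `z`. -/
def sampleVector (g : Z → ℝ) (z : κ → Z) : EuclideanSpace ℝ κ :=
  WithLp.toLp 2 fun i => g (z i)

theorem inner_signVector_sampleVector (ε : κ → ℤˣ) (g : Z → ℝ) (z : κ → Z) :
    inner ℝ (signVector ε) (sampleVector g z) = ∑ i, ((ε i : ℤ) : ℝ) * g (z i) :=
  inner_signVector ε _

theorem norm_sampleVector_le {g : Z → ℝ} (hg : ∀ x, g x ∈ Set.Icc (0 : ℝ) 1) (z : κ → Z) :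
    ‖sampleVector g z‖ ≤ √(Fintype.card κ) := by
  rw [EuclideanSpace.norm_eq]
  refine Real.sqrt_le_sqrt ?_
  calc ∑ i, ‖sampleVector g z i‖ ^ 2 ≤ ∑ _i : κ, (1 : ℝ) :=
        Finset.sum_le_sum fun i _ => pow_le_one₀ (norm_nonneg _)
          ((Real.norm_of_nonneg (hg (z i)).1).trans_le (hg (z i)).2)
    _ = Fintype.card κ := by simp

theorem abs_inner_signVector_sampleVector_le {g : Z → ℝ} (hg : ∀ x, g x ∈ Set.Icc (0 : ℝ) 1)
    (ε : κ → ℤˣ) (z : κ → Z) :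
    |inner ℝ (signVector ε) (sampleVector g z)| ≤ Fintype.card κ := by
  calc |inner ℝ (signVector ε) (sampleVector g z)|
      ≤ ‖signVector ε‖ * ‖sampleVector g z‖ := abs_real_inner_le_norm _ _
    _ ≤ √(Fintype.card κ) * √(Fintype.card κ) := by
        rw [norm_signVector]
        exact mul_le_mul_of_nonneg_left (norm_sampleVector_le hg z) (Real.sqrt_nonneg _)
    _ = Fintype.card κ := Real.mul_self_sqrt (Nat.cast_nonneg _)

theorem bddAbove_range_inner_sampleVector {f : ι → Z → ℝ}
    (hf01 : ∀ a x, f a x ∈ Set.Icc (0 : ℝ) 1) (ε : κ → ℤˣ) (z : κ → Z) :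
    BddAbove (Set.range fun a => inner ℝ (signVector ε) (sampleVector (f a) z)) := by
  refine ⟨Fintype.card κ, ?_⟩
  rintro _ ⟨a, rfl⟩
  exact (le_abs_self _).trans (abs_inner_signVector_sampleVector_le (hf01 a) ε z)

theorem measurable_inner_signVector_sampleVector [MeasurableSpace Z] {g : Z → ℝ}
    (hg : Measurable g) (ε : κ → ℤˣ) :
    Measurable fun z : κ → Z => inner ℝ (signVector ε) (sampleVector g z) := by
  simp only [inner_signVector_sampleVector]
  fun_prop

/-- The supremum, over the class `f`, of the sums over the sample `z` weighted by the signs `ε`. -/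
noncomputable def signedSup (f : ι → Z → ℝ) (ε : κ → ℤˣ) (z : κ → Z) : ℝ :=
  ⨆ a, inner ℝ (signVector ε) (sampleVector (f a) z)

/-- The empirical Rademacher complexity of the class `f` on the sample `z`, not normalised by the
size of the sample. -/
noncomputable def empRademacher [DecidableEq κ] (f : ι → Z → ℝ) (z : κ → Z) : ℝ :=
  rademacher fun a => sampleVector (f a) z

/-- The largest excess, over the class `f`, of the expectation of the sum of the values on a sample
over the sum of the values on the sample `z`. -/
noncomputable def maxDeviation [MeasurableSpace Z] (μ : Measure Z) (f : ι → Z → ℝ) (z : κ → Z) :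
    ℝ :=
  ⨆ a, (Fintype.card κ * ∫ x, f a x ∂μ - ∑ i, f a (z i))

/-- The largest gap, over the class `f`, between the sums over two samples, weighted by the signs
`ε`. -/
noncomputable def signedGap (f : ι → Z → ℝ) (ε : κ → ℤˣ) (p : (κ → Z) × (κ → Z)) : ℝ :=
  ⨆ a, (inner ℝ (signVector ε) (sampleVector (f a) p.2) -
    inner ℝ (signVector ε) (sampleVector (f a) p.1))

theorem abs_signedGap_term_le {g : Z → ℝ} (hg : ∀ x, g x ∈ Set.Icc (0 : ℝ) 1) (ε : κ → ℤˣ)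
    (z z' : κ → Z) :
    |inner ℝ (signVector ε) (sampleVector g z') - inner ℝ (signVector ε) (sampleVector g z)| ≤
      2 * Fintype.card κ := by
  rw [two_mul]
  exact (abs_sub _ _).trans (add_le_add (abs_inner_signVector_sampleVector_le hg ε z')
    (abs_inner_signVector_sampleVector_le hg ε z))

theorem signedGap_swap [DecidableEq κ] (f : ι → Z → ℝ) (ε : κ → ℤˣ) (z z' : κ → Z) :
    signedGap f 1 ((Finset.univ.filter (ε · = 1)).piecewise z z',
      (Finset.univ.filter (ε · = 1)).piecewise z' z) = signedGap f ε (z, z') := by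
  simp only [signedGap, inner_signVector_sampleVector, ← Finset.sum_sub_distrib]
  refine iSup_congr fun a => Finset.sum_congr rfl fun i _ => ?_
  rcases Int.units_eq_one_or (ε i) with hi | hi <;> simp [Finset.piecewise, hi, neg_add_eq_sub]

theorem signedGap_le [Nonempty ι] {f : ι → Z → ℝ}
    (hf01 : ∀ a x, f a x ∈ Set.Icc (0 : ℝ) 1) (ε : κ → ℤˣ)
    (z z' : κ → Z) : signedGap f ε (z, z') ≤ signedSup f (-ε) z + signedSup f ε z' := by
  refine ciSup_le fun a => ?_
  have hneg : inner ℝ (signVector (-ε)) (sampleVector (f a) z) =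
      -inner ℝ (signVector ε) (sampleVector (f a) z) := by
    simp [inner_signVector_sampleVector]
  rw [sub_eq_neg_add, ← hneg]
  exact add_le_add (le_ciSup (bddAbove_range_inner_sampleVector hf01 (-ε) z) a)
    (le_ciSup (bddAbove_range_inner_sampleVector hf01 ε z') a)

variable [MeasurableSpace Z] {μ : Measure Z} [IsProbabilityMeasure μ] {f : ι → Z → ℝ}

theorem integral_mem_Icc {g : Z → ℝ} (hg : ∀ x, g x ∈ Set.Icc (0 : ℝ) 1) :
    ∫ x, g x ∂μ ∈ Set.Icc (0 : ℝ) 1 := by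
  refine ⟨integral_nonneg fun x => (hg x).1, ?_⟩
  have h := norm_integral_le_of_norm_le_const (μ := μ) (f := g) (C := 1)
    (.of_forall fun x => (Real.norm_of_nonneg (hg x).1).trans_le (hg x).2)
  simpa using (le_abs_self _).trans h

theorem abs_deviation_le {g : Z → ℝ} (hg : ∀ x, g x ∈ Set.Icc (0 : ℝ) 1) (z : κ → Z) :
    |Fintype.card κ * ∫ x, g x ∂μ - ∑ i, g (z i)| ≤ Fintype.card κ := by
  have hmean := integral_mem_Icc (μ := μ) hg
  have hsum : ∑ i, g (z i) ≤ Fintype.card κ := by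
    simpa using Finset.sum_le_sum fun i (_ : i ∈ Finset.univ) => (hg (z i)).2
  have hsum_nonneg : 0 ≤ ∑ i, g (z i) := Finset.sum_nonneg fun i _ => (hg (z i)).1
  have hmul := mul_nonneg (Fintype.card κ).cast_nonneg hmean.1
  have hmul_le := mul_le_of_le_one_right (Fintype.card κ).cast_nonneg hmean.2
  exact abs_le.2 ⟨by linarith, by linarith⟩

theorem bddAbove_range_deviation (hf01 : ∀ a x, f a x ∈ Set.Icc (0 : ℝ) 1) (z : κ → Z) :
    BddAbove (Set.range fun a => Fintype.card κ * ∫ x, f a x ∂μ - ∑ i, f a (z i)) := by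
  refine ⟨Fintype.card κ, ?_⟩
  rintro _ ⟨a, rfl⟩
  exact (le_abs_self _).trans (abs_deviation_le (hf01 a) z)

theorem measurePreserving_prod_piecewise [DecidableEq κ] (s : Finset κ) :
    MeasurePreserving
      (fun p : (κ → Z) × (κ → Z) => (s.piecewise p.1 p.2, s.piecewise p.2 p.1))
      ((Measure.pi fun _ => μ).prod (Measure.pi fun _ => μ))
      ((Measure.pi fun _ => μ).prod (Measure.pi fun _ => μ)) := by
  have he := measurePreserving_arrowProdEquivProdArrow Z Z κ (fun _ => μ) (fun _ => μ)
  have hswap : MeasurePreserving (fun (w : κ → Z × Z) i => if i ∈ s then w i else (w i).swap)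
      (Measure.pi fun _ => μ.prod μ) (Measure.pi fun _ => μ.prod μ) :=
    measurePreserving_pi (fun _ : κ => μ.prod μ) (fun _ : κ => μ.prod μ)
      (f := fun i p => if i ∈ s then p else p.swap) fun i => by
        by_cases hi : i ∈ s
        · simpa only [if_pos hi] using! MeasurePreserving.id (μ.prod μ)
        · simpa [hi] using Measure.measurePreserving_swap (μ := μ) (ν := μ)
  convert! he.comp (hswap.comp he.symm) using 1
  ext p i <;> by_cases hi : i ∈ s <;>
    simp [MeasurableEquiv.arrowProdEquivProdArrow, Equiv.arrowProdEquivProdArrow, hi]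

theorem maxDeviation_le_integral_signedGap [Nonempty ι] (hf : ∀ a, Measurable (f a))
    (hf01 : ∀ a x, f a x ∈ Set.Icc (0 : ℝ) 1) {z : κ → Z}
    (hz : Integrable (fun z' => signedGap f 1 (z, z')) (Measure.pi fun _ : κ => μ)) :
    maxDeviation μ f z ≤ ∫ z', signedGap f 1 (z, z') ∂Measure.pi fun _ : κ => μ := by
  set ν := Measure.pi fun _ : κ => μ
  refine ciSup_le fun a => ?_
  have hcoord : ∀ i, Integrable (fun z' : κ → Z => f a (z' i)) ν := fun i =>
    Integrable.of_mem_Icc 0 1 ((hf a).comp (measurable_pi_apply i)).aemeasurable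
      (.of_forall fun z' => hf01 a (z' i))
  have hmean : ∫ z', ∑ i, f a (z' i) ∂ν = Fintype.card κ * ∫ x, f a x ∂μ := by
    rw [integral_finsetSum _ fun i _ => hcoord i]
    simp [ν, integral_comp_eval (μ := fun _ : κ => μ) (hf a).aestronglyMeasurable]
  have hsum := integrable_finsetSum Finset.univ fun i _ => hcoord i
  calc Fintype.card κ * ∫ x, f a x ∂μ - ∑ i, f a (z i)
      = ∫ z', (∑ i, f a (z' i) - ∑ i, f a (z i)) ∂ν := by
        rw [integral_sub hsum (integrable_const _), hmean]
        simp
    _ ≤ ∫ z', signedGap f 1 (z, z') ∂ν := by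
        refine integral_mono (hsum.sub (integrable_const _)) hz fun z' => ?_
        have hbdd : BddAbove (Set.range fun a =>
            inner ℝ (signVector 1) (sampleVector (f a) z') -
              inner ℝ (signVector 1) (sampleVector (f a) z)) := ⟨2 * Fintype.card κ, by
          rintro _ ⟨a, rfl⟩
          exact (le_abs_self _).trans (abs_signedGap_term_le (hf01 a) 1 z z')⟩
        simpa [signedGap, inner_signVector_sampleVector] using le_ciSup hbdd a

variable [Countable ι]

theorem measurable_signedSup (hf : ∀ a, Measurable (f a)) (ε : κ → ℤˣ) :
    Measurable (signedSup f ε) :=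
  Measurable.iSup fun a => measurable_inner_signVector_sampleVector (hf a) ε

theorem measurable_signedGap (hf : ∀ a, Measurable (f a)) (ε : κ → ℤˣ) :
    Measurable (signedGap f ε) :=
  Measurable.iSup fun a =>
    ((measurable_inner_signVector_sampleVector (hf a) ε).comp measurable_snd).sub
      ((measurable_inner_signVector_sampleVector (hf a) ε).comp measurable_fst)

theorem measurable_empRademacher [DecidableEq κ] (hf : ∀ a, Measurable (f a)) :
    Measurable (empRademacher (κ := κ) f) := by
  have h : Measurable fun z : κ → Z => 𝔼 ε, signedSup f ε z := by
    simp only [Finset.expect_eq_sum_div_card]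
    exact (Finset.measurable_sum _ fun ε _ => measurable_signedSup hf ε).div_const _
  exact h

theorem measurable_maxDeviation (μ : Measure Z) (hf : ∀ a, Measurable (f a)) :
    Measurable (maxDeviation (κ := κ) μ f) :=
  Measurable.iSup fun a => by fun_prop

theorem integral_signedGap_eq (hf : ∀ a, Measurable (f a)) (ε : κ → ℤˣ) :
    ∫ p, signedGap f ε p ∂(Measure.pi fun _ : κ => μ).prod (Measure.pi fun _ : κ => μ) =
      ∫ p, signedGap f 1 p ∂(Measure.pi fun _ : κ => μ).prod (Measure.pi fun _ : κ => μ) := by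
  classical
  have hswap := measurePreserving_prod_piecewise (μ := μ) (Finset.univ.filter (ε · = 1))
  rw [← hswap.map_eq, integral_map hswap.measurable.aemeasurable
    (measurable_signedGap hf 1).aestronglyMeasurable, hswap.map_eq]
  simp only [signedGap_swap]

variable [Nonempty ι]

theorem integrable_signedSup (hf : ∀ a, Measurable (f a))
    (hf01 : ∀ a x, f a x ∈ Set.Icc (0 : ℝ) 1) (ε : κ → ℤˣ) :
    Integrable (signedSup f ε) (Measure.pi fun _ : κ => μ) :=
  integrable_iSup (fun a => measurable_inner_signVector_sampleVector (hf a) ε)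
    fun a z => abs_inner_signVector_sampleVector_le (hf01 a) ε z

theorem integrable_signedGap (hf : ∀ a, Measurable (f a))
    (hf01 : ∀ a x, f a x ∈ Set.Icc (0 : ℝ) 1) (ε : κ → ℤˣ) :
    Integrable (signedGap f ε)
      ((Measure.pi fun _ : κ => μ).prod (Measure.pi fun _ : κ => μ)) :=
  Integrable.of_bound (measurable_signedGap hf ε).aestronglyMeasurable (2 * Fintype.card κ)
    (.of_forall fun p => abs_ciSup_le fun a => abs_signedGap_term_le (hf01 a) ε p.1 p.2)

theorem integrable_maxDeviation (hf : ∀ a, Measurable (f a))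
    (hf01 : ∀ a x, f a x ∈ Set.Icc (0 : ℝ) 1) :
    Integrable (maxDeviation μ f) (Measure.pi fun _ : κ => μ) :=
  integrable_iSup (fun a => by fun_prop) fun a z => abs_deviation_le (hf01 a) z

theorem integral_signedGap_le (hf : ∀ a, Measurable (f a))
    (hf01 : ∀ a x, f a x ∈ Set.Icc (0 : ℝ) 1) (ε : κ → ℤˣ) :
    ∫ p, signedGap f ε p ∂(Measure.pi fun _ : κ => μ).prod (Measure.pi fun _ : κ => μ) ≤
      ∫ z, signedSup f (-ε) z ∂(Measure.pi fun _ : κ => μ) +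
      ∫ z, signedSup f ε z ∂(Measure.pi fun _ : κ => μ) := by
  set ν := Measure.pi fun _ : κ => μ
  have hfst := (integrable_signedSup (μ := μ) hf hf01 (-ε)).comp_fst ν
  have hsnd := (integrable_signedSup (μ := μ) hf hf01 ε).comp_snd ν
  calc ∫ p, signedGap f ε p ∂ν.prod ν
      ≤ ∫ p, (signedSup f (-ε) p.1 + signedSup f ε p.2) ∂ν.prod ν :=
        integral_mono (integrable_signedGap hf hf01 ε) (hfst.add hsnd)
          fun p => signedGap_le hf01 ε p.1 p.2
    _ = ∫ z, signedSup f (-ε) z ∂ν + ∫ z, signedSup f ε z ∂ν := by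
        rw [integral_add hfst hsnd, integral_fun_fst, integral_fun_snd]
        simp [ν]

theorem integral_maxDeviation_le_integral_signedGap (hf : ∀ a, Measurable (f a))
    (hf01 : ∀ a x, f a x ∈ Set.Icc (0 : ℝ) 1) :
    ∫ z, maxDeviation μ f z ∂(Measure.pi fun _ : κ => μ) ≤
      ∫ p, signedGap f 1 p ∂(Measure.pi fun _ : κ => μ).prod (Measure.pi fun _ : κ => μ) := by
  have hintegrable := integrable_signedGap (μ := μ) (κ := κ) hf hf01 1
  rw [integral_prod _ hintegrable]
  exact integral_mono_ae (integrable_maxDeviation hf hf01) hintegrable.integral_prod_left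
    (hintegrable.prod_right_ae.mono fun z hz => maxDeviation_le_integral_signedGap hf hf01 hz)

theorem integral_empRademacher [DecidableEq κ] (hf : ∀ a, Measurable (f a))
    (hf01 : ∀ a x, f a x ∈ Set.Icc (0 : ℝ) 1) :
    ∫ z, empRademacher f z ∂(Measure.pi fun _ : κ => μ) =
      𝔼 ε, ∫ z, signedSup f ε z ∂(Measure.pi fun _ : κ => μ) := by
  change ∫ z, 𝔼 ε, signedSup f ε z ∂_ = _
  simp only [Finset.expect_eq_sum_div_card]
  rw [integral_div, integral_finsetSum _ fun ε _ => integrable_signedSup hf hf01 ε]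

theorem integrable_empRademacher [DecidableEq κ] (hf : ∀ a, Measurable (f a))
    (hf01 : ∀ a x, f a x ∈ Set.Icc (0 : ℝ) 1) :
    Integrable (empRademacher f) (Measure.pi fun _ : κ => μ) := by
  change Integrable (fun z => 𝔼 ε, signedSup f ε z) _
  simp only [Finset.expect_eq_sum_div_card]
  exact (integrable_finsetSum _ fun ε _ => integrable_signedSup hf hf01 ε).div_const _

/-- Symmetrisation: exchanging the members of the pairs formed by a sample and an independent copy
of it does not change the law of the pair, so that one may insert signs in their gap, and then
average over the signs. -/
theorem integral_maxDeviation_le [DecidableEq κ] (hf : ∀ a, Measurable (f a))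
    (hf01 : ∀ a x, f a x ∈ Set.Icc (0 : ℝ) 1) :
    ∫ z, maxDeviation μ f z ∂(Measure.pi fun _ : κ => μ) ≤
      2 * ∫ z, empRademacher f z ∂(Measure.pi fun _ : κ => μ) := by
  have hsign : ∀ ε : κ → ℤˣ, ∫ z, maxDeviation μ f z ∂(Measure.pi fun _ : κ => μ) ≤
      ∫ z, signedSup f (-ε) z ∂(Measure.pi fun _ : κ => μ) +
      ∫ z, signedSup f ε z ∂(Measure.pi fun _ : κ => μ) := fun ε =>
    (integral_maxDeviation_le_integral_signedGap hf hf01).trans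
      ((integral_signedGap_eq hf ε).symm.trans_le (integral_signedGap_le hf hf01 ε))
  have hneg : 𝔼 ε, ∫ z, signedSup f (-ε) z ∂(Measure.pi fun _ : κ => μ) =
      𝔼 ε, ∫ z, signedSup f ε z ∂(Measure.pi fun _ : κ => μ) :=
    Fintype.expect_equiv (Equiv.neg (κ → ℤˣ)) _ _ fun _ => rfl
  calc ∫ z, maxDeviation μ f z ∂(Measure.pi fun _ : κ => μ)
      ≤ 𝔼 ε, (∫ z, signedSup f (-ε) z ∂(Measure.pi fun _ : κ => μ) +
          ∫ z, signedSup f ε z ∂(Measure.pi fun _ : κ => μ)) :=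
        Finset.le_expect Finset.univ_nonempty fun ε _ => hsign ε
    _ = 2 * ∫ z, empRademacher f z ∂(Measure.pi fun _ : κ => μ) := by
        rw [Finset.expect_add_distrib, hneg, integral_empRademacher hf hf01, two_mul]

end Symmetrization

section EntropyBound

theorem natLog_two_le (n : ℕ) : (Nat.log 2 n : ℝ) ≤ 3 / 2 * Real.log n := by
  have hlog : 0 ≤ Real.log n := Real.log_natCast_nonneg n
  refine (Real.natLog_le_logb n 2).trans ?_
  rw [Nat.cast_ofNat, Real.logb, div_le_iff₀ (Real.log_pos one_lt_two)]
  nlinarith [Real.log_two_gt_d9]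

theorem div_two_pow_log_le (n : ℕ) : (n : ℝ) / 2 ^ Nat.log 2 n ≤ 2 := by
  rw [div_le_iff₀ (by positivity), ← pow_succ']
  exact_mod_cast (Nat.lt_pow_succ_log_self one_lt_two n).le

theorem empRademacher_le_of_entropy {ι Z κ : Type*} [Nonempty ι] [Fintype κ] [DecidableEq κ]
    [Nonempty κ] {f : ι → Z → ℝ} (hf01 : ∀ a x, f a x ∈ Set.Icc (0 : ℝ) 1) (z : κ → Z) {q : ℝ}
    (hq : 0 ≤ q) (hcov : ∀ ε : ℝ, 0 < ε → ∃ N : ℕ, Real.log N ≤ q ^ 2 / ε ^ 2 ∧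
      HasCover (Set.range fun a => sampleVector (f a) z) ε N) :
    empRademacher f z ≤ 2 + 9 * Real.log (Fintype.card κ) * q := by
  have hn : (0 : ℝ) < Fintype.card κ := Nat.cast_pos.2 Fintype.card_pos
  calc empRademacher f z
      ≤ √(Fintype.card κ) * (√(Fintype.card κ) / 2 ^ Nat.log 2 (Fintype.card κ)) +
          Nat.log 2 (Fintype.card κ) * (6 * q) :=
        rademacher_le_of_entropy (Real.sqrt_pos.2 hn) (fun a => norm_sampleVector_le (hf01 a) z)
          hq hcov _
    _ ≤ 2 + 3 / 2 * Real.log (Fintype.card κ) * (6 * q) := by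
        rw [← mul_div_assoc, Real.mul_self_sqrt hn.le]
        gcongr
        · exact div_two_pow_log_le _
        · exact natLog_two_le _
    _ = 2 + 9 * Real.log (Fintype.card κ) * q := by ring

end EntropyBound

section UniformDeviation

theorem sum_mul_update {κ Z : Type*} [Fintype κ] [DecidableEq κ] (u : κ → ℝ) (g : Z → ℝ)
    (z : κ → Z) (i : κ) (w : Z) :
    ∑ j, u j * g (Function.update z i w j) = ∑ j, u j * g (z j) + u i * (g w - g (z i)) := by
  rw [← sub_eq_iff_eq_add', ← Finset.sum_sub_distrib, Finset.sum_eq_single i]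
  · rw [Function.update_self, mul_sub]
  · intro j _ hj
    rw [Function.update_of_ne hj, sub_self]
  · simp

variable {ι Z κ : Type*} [Fintype κ] [DecidableEq κ] {f : ι → Z → ℝ}

theorem empRademacher_comp_le {τ : Type*} [Nonempty τ] (hf01 : ∀ a x, f a x ∈ Set.Icc (0 : ℝ) 1)
    (e : τ → ι) (z : κ → Z) : empRademacher (f ∘ e) z ≤ empRademacher f z :=
  Finset.expect_le_expect fun ε _ => ciSup_le fun t =>
    le_ciSup (bddAbove_range_inner_sampleVector hf01 ε z) (e t)

theorem empRademacher_le_update [Nonempty ι] (hf01 : ∀ a x, f a x ∈ Set.Icc (0 : ℝ) 1) (i : κ)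
    (z : κ → Z) (w : Z) : empRademacher f z ≤ empRademacher f (Function.update z i w) + 1 := by
  simp only [empRademacher, rademacher]
  rw [← Fintype.expect_const (ι := κ → ℤˣ) (1 : ℝ), ← Finset.expect_add_distrib]
  refine Finset.expect_le_expect fun ε _ =>
    ciSup_le_ciSup_add (bddAbove_range_inner_sampleVector hf01 ε _) fun a => ?_
  rw [inner_signVector_sampleVector, inner_signVector_sampleVector, sum_mul_update, add_assoc]
  refine le_add_of_nonneg_right ?_
  obtain ⟨hw0, hw1⟩ := hf01 a w
  obtain ⟨hz0, hz1⟩ := hf01 a (z i)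
  rcases Int.units_eq_one_or (ε i) with hi | hi <;> simp only [hi, Units.val_one,
    Units.val_neg, Int.cast_one, Int.cast_neg] <;> linarith

variable [MeasurableSpace Z] {μ : Measure Z} [IsProbabilityMeasure μ]

theorem integral_le_of_maxDeviation_le {n : ℕ} (hn : 0 < n)
    (hf01 : ∀ a x, f a x ∈ Set.Icc (0 : ℝ) 1) {z : Fin n → Z} {R t : ℝ}
    (h : maxDeviation μ f z ≤ R + n * t) (a : ι) :
    ∫ x, f a x ∂μ ≤ (n : ℝ)⁻¹ * ∑ i, f a (z i) + R / n + t := by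
  have hdev := (le_ciSup (bddAbove_range_deviation (μ := μ) hf01 z) a).trans h
  rw [Fintype.card_fin] at hdev
  have hn0 : (0 : ℝ) < n := Nat.cast_pos.2 hn
  refine le_of_mul_le_mul_left ?_ hn0
  calc n * ∫ x, f a x ∂μ ≤ ∑ i, f a (z i) + R + n * t := by linarith
    _ = n * ((n : ℝ)⁻¹ * ∑ i, f a (z i) + R / n + t) := by field_simp

variable [Nonempty ι]

theorem maxDeviation_update_le (hf01 : ∀ a x, f a x ∈ Set.Icc (0 : ℝ) 1) (i : κ) (z : κ → Z)
    (w : Z) : maxDeviation μ f (Function.update z i w) ≤ maxDeviation μ f z + 1 := by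
  refine ciSup_le_ciSup_add (bddAbove_range_deviation hf01 z) fun a => ?_
  have hsum := sum_mul_update (fun _ => 1) (f a) z i w
  simp only [one_mul] at hsum
  linarith [(hf01 a w).1, (hf01 a (z i)).2]

theorem measureReal_empRademacher_add_le_maxDeviation_le [Countable ι] {n : ℕ} (hn : 0 < n)
    (hf : ∀ a, Measurable (f a)) (hf01 : ∀ a x, f a x ∈ Set.Icc (0 : ℝ) 1) {δ : ℝ} (hδ : 0 < δ)
    (hδ1 : δ ≤ 1) :
    (Measure.pi fun _ : Fin n => μ).real {z | 2 * empRademacher f z +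
      n * (3 * √(Real.log (1 / δ) / (2 * n))) ≤ maxDeviation μ f z} ≤ δ := by
  have hlog : 0 ≤ Real.log (1 / δ) := Real.log_nonneg (one_le_one_div hδ hδ1)
  set ν := Measure.pi fun _ : Fin n => μ
  set u := n * (3 * √(Real.log (1 / δ) / (2 * n)))
  set g : (Fin n → Z) → ℝ := fun z => maxDeviation μ f z - 2 * empRademacher f z
  have hg : Measurable g :=
    (measurable_maxDeviation μ hf).sub ((measurable_empRademacher hf).const_mul 2)
  have hdiff : ∀ i z w, g (Function.update z i w) ≤ g z + (3 : ℝ≥0) := fun i z w => by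
    simp only [g, NNReal.coe_ofNat]
    linarith [maxDeviation_update_le (μ := μ) hf01 i z w, empRademacher_le_update hf01 i z w]
  have hmean : ∫ z, g z ∂ν ≤ 0 := by
    rw [integral_sub (integrable_maxDeviation hf hf01)
      ((integrable_empRademacher hf hf01).const_mul 2), integral_const_mul, sub_nonpos]
    exact integral_maxDeviation_le hf hf01
  calc ν.real {z | 2 * empRademacher f z + u ≤ maxDeviation μ f z}
      ≤ ν.real {z | ∫ z, g z ∂ν + u ≤ g z} := by
        refine measureReal_mono (Set.ofPred_subset_ofPred.2 fun z hz => ?_)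
        simp only [g] at hmean ⊢
        linarith
    _ ≤ Real.exp (-(2 * u ^ 2) / ∑ _i : Fin n, ((3 : ℝ≥0) : ℝ) ^ 2) :=
        measureReal_add_integral_le_le_of_update_le _ hg hdiff (by positivity)
    _ = δ := by
        have hexp : -(2 * u ^ 2) / ∑ _i : Fin n, ((3 : ℝ≥0) : ℝ) ^ 2 = Real.log δ := by
          rw [show u ^ 2 = n ^ 2 * (9 * (Real.log (1 / δ) / (2 * n))) by
            rw [mul_pow, mul_pow, Real.sq_sqrt (by positivity)]
            norm_num]
          simp only [Finset.sum_const, Finset.card_univ, Fintype.card_fin, nsmul_eq_mul,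
            NNReal.coe_ofNat, one_div, Real.log_inv]
          field_simp
          ring
        rw [hexp, Real.exp_log hδ]

section Separable

variable {Θ : Type*} [TopologicalSpace Θ] [FirstCountableTopology Θ] {n : ℕ} {f : Θ → Z → ℝ}

theorem integral_le_of_denseRange {τ : Type*} {e : τ → Θ} (he : DenseRange e) (hn : 0 < n)
    (hf : ∀ θ, Measurable (f θ)) (hcont : ∀ x, Continuous fun θ => f θ x)
    (hf01 : ∀ θ x, f θ x ∈ Set.Icc (0 : ℝ) 1) {z : Fin n → Z} {t : ℝ}
    (h : maxDeviation μ (f ∘ e) z ≤ 2 * empRademacher (f ∘ e) z + n * t) (θ : Θ) :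
    ∫ x, f θ x ∂μ ≤ (n : ℝ)⁻¹ * ∑ i, f θ (z i) + 2 * empRademacher f z / n + t := by
  have hintegrable : Continuous fun θ => ∫ x, f θ x ∂μ :=
    continuous_of_dominated (fun θ => (hf θ).aestronglyMeasurable)
      (fun θ => .of_forall fun x => (Real.norm_of_nonneg (hf01 θ x).1).trans_le (hf01 θ x).2)
      (integrable_const 1) (.of_forall hcont)
  refine he.induction_on θ (isClosed_le hintegrable (by fun_prop)) fun k => ?_
  have : Nonempty τ := ⟨k⟩
  have hk := integral_le_of_maxDeviation_le hn (fun k => hf01 (e k)) h k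
  have hR : 2 * empRademacher (f ∘ e) z / n ≤ 2 * empRademacher f z / n := by
    have := empRademacher_comp_le hf01 e z
    gcongr
  exact hk.trans (by linarith)

theorem one_sub_le_measureReal_integral_le [TopologicalSpace.SeparableSpace Θ] (hn : 0 < n)
    (hf : ∀ θ, Measurable (f θ)) (hcont : ∀ x, Continuous fun θ => f θ x)
    (hf01 : ∀ θ x, f θ x ∈ Set.Icc (0 : ℝ) 1) {δ : ℝ} (hδ : 0 < δ) (hδ1 : δ ≤ 1) :
    1 - δ ≤ (Measure.pi fun _ : Fin n => μ).real
      {z | ∀ θ, ∫ x, f θ x ∂μ ≤ (n : ℝ)⁻¹ * ∑ i, f θ (z i) + 2 * empRademacher f z / n +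
        3 * √(Real.log (1 / δ) / (2 * n))} := by
  rcases isEmpty_or_nonempty Θ with _ | _
  · simpa using hδ.le
  set e := TopologicalSpace.denseSeq Θ
  set ν := Measure.pi fun _ : Fin n => μ
  set bad := {z : Fin n → Z | 2 * empRademacher (f ∘ e) z +
    n * (3 * √(Real.log (1 / δ) / (2 * n))) ≤ maxDeviation μ (f ∘ e) z}
  have hbad : MeasurableSet bad :=
    measurableSet_le (((measurable_empRademacher fun k => hf (e k)).const_mul 2).add_const _)
      (measurable_maxDeviation μ fun k => hf (e k))
  have hbadδ : ν.real bad ≤ δ := measureReal_empRademacher_add_le_maxDeviation_le hn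
    (fun k => hf (e k)) (fun k => hf01 (e k)) hδ hδ1
  calc 1 - δ ≤ 1 - ν.real bad := sub_le_sub_left hbadδ 1
    _ = ν.real badᶜ := (probReal_compl_eq_one_sub hbad).symm
    _ ≤ _ := measureReal_mono (Set.subset_ofPred.2 fun z hz =>
        integral_le_of_denseRange (TopologicalSpace.denseRange_denseSeq Θ) hn hf hcont hf01
          (le_of_not_ge hz))

end Separable

end UniformDeviation

section Loss

variable {a k : ℕ} {γ : ℝ}

theorem abs_iSup_sub_iSup_le {ι : Type*} [Finite ι] {g h : ι → ℝ} {K : ℝ} (hK : 0 ≤ K)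
    (H : ∀ i, |g i - h i| ≤ K) : |(⨆ i, g i) - ⨆ i, h i| ≤ K := by
  rcases isEmpty_or_nonempty ι with _ | _
  · simpa
  refine abs_sub_le_iff.2 ⟨sub_le_iff_le_add'.2 ?_, sub_le_iff_le_add'.2 ?_⟩
  · exact ciSup_le_ciSup_add (Set.finite_range h).bddAbove
      fun i => by linarith [(abs_sub_le_iff.1 (H i)).1]
  · exact ciSup_le_ciSup_add (Set.finite_range g).bddAbove
      fun i => by linarith [(abs_sub_le_iff.1 (H i)).2]

theorem lipschitzWith_margin (y : Fin k) : LipschitzWith 2 fun v : E k => margin v y := by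
  refine LipschitzWith.of_dist_le_mul fun v w => ?_
  have hcoord : ∀ j, |v j - w j| ≤ dist v w := fun j => by
    rw [dist_eq_norm]
    exact PiLp.norm_apply_le (v - w) j
  have hsup := abs_iSup_sub_iSup_le dist_nonneg fun j : {j : Fin k // j ≠ y} => hcoord j
  rw [Real.dist_eq, margin, margin, sub_sub_sub_comm, NNReal.coe_ofNat, two_mul]
  exact (abs_sub _ _).trans (add_le_add (hcoord y) hsup)

theorem IsArgmax.margin_nonpos_of_ne {am : E k → Fin k} (ham : IsArgmax am) {v : E k} {y : Fin k}
    (h : am v ≠ y) : margin v y ≤ 0 :=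
  sub_nonpos.2 <| (ham v y).trans <|
    le_ciSup (f := fun j : {j : Fin k // j ≠ y} => v j) (Set.finite_range _).bddAbove ⟨am v, h⟩

theorem ramp_eq (hγ : 0 < γ) : ramp γ = fun r => max 0 (min 1 (1 + r / γ)) := by
  ext r
  rw [ramp]
  split_ifs with hlow hneg
  · have : r / γ < -1 := by rwa [div_lt_iff₀ hγ, neg_one_mul]
    rw [max_eq_left ((min_le_right _ _).trans (by linarith))]
  · have hge : -1 ≤ r / γ := by
      rw [le_div_iff₀ hγ]
      linarith
    have hle : r / γ ≤ 0 := div_nonpos_of_nonpos_of_nonneg hneg hγ.le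
    rw [min_eq_right (by linarith), max_eq_right (by linarith)]
  · have : 0 < r / γ := div_pos (not_le.1 hneg) hγ
    rw [min_eq_left (by linarith), max_eq_right zero_le_one]

theorem ramp_mem_Icc (hγ : 0 < γ) (r : ℝ) : ramp γ r ∈ Set.Icc (0 : ℝ) 1 := by
  rw [ramp_eq hγ]
  exact ⟨le_max_left _ _, max_le zero_le_one (min_le_left _ _)⟩

theorem one_le_ramp (hγ : 0 < γ) {r : ℝ} (hr : 0 ≤ r) : 1 ≤ ramp γ r := by
  rw [ramp_eq hγ]
  exact le_max_of_le_right (le_min le_rfl (by linarith [div_nonneg hr hγ.le]))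

theorem lipschitzWith_ramp (hγ : 0 < γ) : LipschitzWith (γ⁻¹).toNNReal (ramp γ) := by
  rw [ramp_eq hγ]
  refine (LipschitzWith.const_min (.of_dist_le_mul fun r r' => ?_) 1).const_max 0
  rw [dist_add_left, Real.coe_toNNReal _ (inv_nonneg.2 hγ.le), Real.dist_eq, Real.dist_eq,
    ← sub_div, abs_div, abs_of_pos hγ, div_eq_inv_mul]

theorem lipschitzWith_ramp_neg_margin (hγ : 0 < γ) (y : Fin k) :
    LipschitzWith ((γ⁻¹).toNNReal * 2) fun v : E k => ramp γ (-margin v y) :=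
  (lipschitzWith_ramp hγ).comp (lipschitzWith_margin y).neg

/-- The ramp loss of the margin of the predictor `f` at a labelled point. -/
noncomputable def marginLoss (γ : ℝ) (f : E a → E k) (p : E a × Fin k) : ℝ :=
  ramp γ (-margin (f p.1) p.2)

theorem marginLoss_mem_Icc (hγ : 0 < γ) (f : E a → E k) (p : E a × Fin k) :
    marginLoss γ f p ∈ Set.Icc (0 : ℝ) 1 :=
  ramp_mem_Icc hγ _

theorem measurable_marginLoss (hγ : 0 < γ) {f : E a → E k} (hf : Continuous f) :
    Measurable (marginLoss γ f) :=
  measurable_from_prod_countable_left fun y =>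
    ((lipschitzWith_ramp_neg_margin hγ y).continuous.comp hf).measurable

theorem errorProb_le_integral_marginLoss (hγ : 0 < γ) {μ : Measure (E a × Fin k)}
    [IsFiniteMeasure μ] {am : E k → Fin k} (ham : IsArgmax am) {f : E a → E k}
    (hf : Continuous f) : errorProb μ am f ≤ ∫ p, marginLoss γ f p ∂μ := by
  have hintegrable : Integrable (marginLoss γ f) μ :=
    Integrable.of_mem_Icc 0 1 (measurable_marginLoss hγ hf).aemeasurable
      (.of_forall (marginLoss_mem_Icc hγ f))
  have hmarkov := mul_meas_ge_le_integral_of_nonneg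
    (.of_forall fun p => (marginLoss_mem_Icc hγ f p).1) hintegrable 1
  rw [one_mul] at hmarkov
  refine (measureReal_mono (Set.ofPred_subset_ofPred.2 fun p hp => ?_)).trans hmarkov
  exact one_le_ramp hγ (neg_nonneg.2 (ham.margin_nonpos_of_ne hp))

theorem HasCover.range_sampleVector_marginLoss (hγ : 0 < γ) {κ ι : Type*} [Fintype κ]
    {f : ι → E a → E k} {S : κ → E a × Fin k} {ε : ℝ} {N : ℕ}
    (h : HasCover (Set.range fun i => mapBatch (f i) (WithLp.toLp 2 fun t => (S t).1)) ε N) :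
    HasCover (Set.range fun i => sampleVector (marginLoss γ (f i)) S) (2 / γ * ε) N := by
  refine (h.image_lipschitz (lipschitzWith_toLp_apply fun t =>
    lipschitzWith_ramp_neg_margin hγ (S t).2)).mono ?_ (le_of_eq ?_) le_rfl
  · rintro _ ⟨i, rfl⟩
    exact ⟨_, ⟨i, rfl⟩, rfl⟩
  · rw [NNReal.coe_mul, Real.coe_toNNReal _ (inv_nonneg.2 hγ.le), NNReal.coe_ofNat, inv_mul_eq_div]

end Loss

section NetworkRisk

variable {L : ℕ} {d : Fin (L + 1) → ℕ} {m : Fin L → ℕ}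

theorem le_width_left (d : Fin (L + 1) → ℕ) (m : Fin L → ℕ) (l : Fin (L + 1)) : d l ≤ width d m :=
  (Finset.le_sup (f := d) (Finset.mem_univ l)).trans (le_max_left _ _)

theorem le_width_right (d : Fin (L + 1) → ℕ) (m : Fin L → ℕ) (i : Fin L) : m i ≤ width d m :=
  (Finset.le_sup (f := m) (Finset.mem_univ i)).trans (le_max_right _ _)

theorem two_mul_mul_add_one_le_two_mul_width_sq (hW : 1 ≤ width d m) (i : Fin L) :
    2 * (m i * d i.castSucc) + 1 ≤ (2 * width d m) ^ 2 := by
  have := Nat.mul_le_mul (le_width_right d m i) (le_width_left d m i.castSucc)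
  nlinarith

theorem sqrt_two_mul_log_two_mul_le {W : ℝ} (hW : 1 ≤ W) :
    √(2 * Real.log (2 * W)) ≤ 2 * Real.log (2 * W) := by
  have hlog : Real.log 2 ≤ Real.log (2 * W) := Real.log_le_log two_pos (by linarith)
  exact Real.sqrt_le_iff.2 ⟨by linarith [Real.log_two_gt_d9],
    by nlinarith [Real.log_two_gt_d9]⟩

variable {σ : ∀ i : Fin L, E (m i) → E (d i.succ)} {ρ : Fin L → ℝ≥0}
  {M : ∀ i : Fin L, Matrix (Fin (m i)) (Fin (d i.castSucc)) ℝ} {s : Fin L → ℝ≥0} {b : Fin L → ℝ}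
  {γ B : ℝ}

theorem nonneg_of_mem_weightClass {s : Fin L → ℝ}
    {A : ∀ i : Fin L, Matrix (Fin (m i)) (Fin (d i.castSucc)) ℝ} (hA : A ∈ weightClass M s b)
    (i : Fin L) : 0 ≤ b i :=
  (norm21_nonneg _).trans (hA i).2

theorem exists_hasCover_range_sampleVector_network {κ : Type*} [Fintype κ]
    (hσ : ∀ i, LipschitzWith (ρ i) (σ i))
    (hσ0 : ∀ i, σ i 0 = 0) (hs : ∀ i, 0 < s i) (hb : ∀ i, 0 ≤ b i) (hγ : 0 < γ)
    (hW : 1 ≤ width d m) {S : κ → E (d 0) × Fin (d (Fin.last L))}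
    (hS : √(∑ i, ‖(S i).1‖ ^ 2) ≤ B) {ε : ℝ} (hε : 0 < ε) :
    ∃ N : ℕ, Real.log N ≤ (2 / γ * (B * spectralComplexity ρ (fun i => s i) b) *
        √(2 * Real.log (2 * width d m))) ^ 2 / ε ^ 2 ∧
      HasCover (Set.range fun A : weightClass M (fun i => s i) b =>
        sampleVector (marginLoss γ (network σ A)) S) ε N := by
  set X : Batch κ (E (d 0)) := WithLp.toLp 2 fun i => (S i).1
  have hX : ‖X‖ ≤ B := (PiLp.norm_eq_of_L2 X).trans_le hS
  have hlog : 0 ≤ 2 * Real.log (2 * (width d m : ℝ)) := by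
    have : (1 : ℝ) ≤ width d m := Nat.one_le_cast.2 hW
    exact mul_nonneg zero_le_two (Real.log_nonneg (by linarith))
  have hQ := spectralComplexity_nonneg (ρ := ρ) (fun i => (s i).2) hb
  obtain ⟨K, hK, hcov⟩ := exists_hasCover_mapBatch_network (M := M) hσ hσ0 hs hb X
    (two_mul_mul_add_one_le_two_mul_width_sq hW) (ε := ε / (2 / γ)) (by positivity)
  rw [Set.image_eq_range] at hcov
  refine ⟨_, ?_, (HasCover.range_sampleVector_marginLoss hγ hcov).mono subset_rfl
    (mul_div_cancel₀ ε (by positivity)).le le_rfl⟩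
  calc Real.log (((2 * width d m) ^ 2) ^ K : ℕ)
      = K * (2 * Real.log (2 * width d m)) := by
        push_cast
        rw [Real.log_pow, Real.log_pow, Nat.cast_ofNat]
    _ ≤ (B * spectralComplexity ρ (fun i => s i) b) ^ 2 / (ε / (2 / γ)) ^ 2 *
          (2 * Real.log (2 * width d m)) := by
        gcongr
        exact hK.trans (by gcongr)
    _ = _ := by
        rw [mul_pow _ √_, Real.sq_sqrt hlog]
        field_simp

theorem empRademacher_marginLoss_network_le {n : ℕ} (hn : 0 < n)
    (hσ : ∀ i, LipschitzWith (ρ i) (σ i)) (hσ0 : ∀ i, σ i 0 = 0) (hs : ∀ i, 0 < s i)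
    (hM : (weightClass M (fun i => s i) b).Nonempty) (hγ : 0 < γ) (hW : 1 ≤ width d m)
    {S : Fin n → E (d 0) × Fin (d (Fin.last L))} (hS : √(∑ i, ‖(S i).1‖ ^ 2) ≤ B) :
    empRademacher (fun A : weightClass M (fun i => s i) b => marginLoss γ (network σ A)) S ≤
      2 + 36 * B * Real.log (2 * width d m) * Real.log n / γ *
        spectralComplexity ρ (fun i => s i) b := by
  have hb := nonneg_of_mem_weightClass hM.some_mem
  set Q := spectralComplexity ρ (fun i => s i) b
  have hQ : 0 ≤ Q := spectralComplexity_nonneg (fun i => (s i).2) hb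
  have hB : 0 ≤ B := (Real.sqrt_nonneg _).trans hS
  have := Real.log_natCast_nonneg n
  have : Nonempty (Fin n) := ⟨⟨0, hn⟩⟩
  have := hM.to_subtype
  have hrad := empRademacher_le_of_entropy
    (f := fun A : weightClass M (fun i => s i) b => marginLoss γ (network σ A))
    (fun A => marginLoss_mem_Icc hγ (network σ A)) S (by positivity)
    fun ε hε => exists_hasCover_range_sampleVector_network hσ hσ0 hs hb hγ hW hS hε
  rw [Fintype.card_fin] at hrad
  calc _ ≤ 2 + 9 * Real.log n * (2 / γ * (B * Q) * √(2 * Real.log (2 * width d m))) := hrad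
    _ ≤ 2 + 9 * Real.log n * (2 / γ * (B * Q) * (2 * Real.log (2 * width d m))) := by
        gcongr
        exact sqrt_two_mul_log_two_mul_le (Nat.one_le_cast.2 hW)
    _ = 2 + 36 * B * Real.log (2 * width d m) * Real.log n / γ * Q := by ring

theorem one_sub_le_measureReal_integral_marginLoss_network_le (hσ : ∀ i, Continuous (σ i))
    (hγ : 0 < γ) (Θ : Set (∀ i : Fin L, Matrix (Fin (m i)) (Fin (d i.castSucc)) ℝ))
    {μ : Measure (E (d 0) × Fin (d (Fin.last L)))} [IsProbabilityMeasure μ] {n : ℕ} (hn : 0 < n)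
    {δ : ℝ} (hδ : 0 < δ) (hδ1 : δ ≤ 1) :
    1 - δ ≤ (Measure.pi fun _ : Fin n => μ).real
      {S | ∀ A : Θ, ∫ p, marginLoss γ (network σ A) p ∂μ ≤ empRampRisk γ (network σ A) S +
        2 * empRademacher (fun A : Θ => marginLoss γ (network σ A)) S / n +
        3 * √(Real.log (1 / δ) / (2 * n))} := by
  have : ∀ i, SecondCountableTopology (Matrix (Fin (m i)) (Fin (d i.castSucc)) ℝ) := fun i =>
    inferInstanceAs (SecondCountableTopology (Fin (m i) → Fin (d i.castSucc) → ℝ))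
  have hmeas : ∀ A : Θ, Measurable (marginLoss γ (network σ A)) := fun A =>
    measurable_marginLoss hγ ((continuous_network hσ).comp (Continuous.prodMk_right A.1))
  have hcont : ∀ p : E (d 0) × Fin (d (Fin.last L)),
      Continuous fun A : Θ => marginLoss γ (network σ A) p := fun p =>
    (lipschitzWith_ramp_neg_margin hγ p.2).continuous.comp
      ((continuous_network hσ).comp (continuous_subtype_val.prodMk continuous_const))
  exact one_sub_le_measureReal_integral_le (f := fun A : Θ => marginLoss γ (network σ A)) hn hmeas
    hcont (fun A => marginLoss_mem_Icc hγ (network σ A)) hδ hδ1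

end NetworkRisk

end SpectralMargin

open SpectralMargin

theorem mainTheorem6
    {L : ℕ} (d : Fin (L + 1) → ℕ) (m : Fin L → ℕ)
    (σ : ∀ i : Fin L, SpectralMargin.E (m i) → SpectralMargin.E (d i.succ))
    (ρ : Fin L → ℝ≥0)
    (hσ : ∀ i, LipschitzWith (ρ i) (σ i)) (hσ0 : ∀ i, σ i 0 = 0)
    (M : ∀ i : Fin L, Matrix (Fin (m i)) (Fin (d i.castSucc)) ℝ)
    (am : SpectralMargin.E (d (Fin.last L)) → Fin (d (Fin.last L)))
    (ham : SpectralMargin.IsArgmax am)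
    (γ : ℝ) (hγ : 0 < γ) (B : ℝ)
    (s b : Fin L → ℝ) (hs : ∀ i, 0 < s i)
    (μ : Measure (SpectralMargin.E (d 0) × Fin (d (Fin.last L)))) [IsProbabilityMeasure μ]
    (n : ℕ) (hn : 0 < n) (δ : ℝ) (hδ : 0 < δ) (hδ1 : δ ≤ 1) :
    1 - δ ≤ (Measure.pi fun _ : Fin n => μ).real
      {S | Real.sqrt (∑ i, ‖(S i).1‖ ^ 2) ≤ B →
        ∀ A : ∀ i : Fin L, Matrix (Fin (m i)) (Fin (d i.castSucc)) ℝ,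
          (∀ i, SpectralMargin.specNorm (A i) ≤ s i) →
          (∀ i, SpectralMargin.norm21 ((A i)ᵀ - (M i)ᵀ) ≤ b i) →
          SpectralMargin.errorProb μ am (SpectralMargin.network σ A) ≤
            SpectralMargin.empRampRisk γ (SpectralMargin.network σ A) S
            + 8 / n
            + 72 * B * Real.log (2 * (SpectralMargin.width d m : ℝ)) * Real.log n / (γ * n)
              * (∏ i, s i * (ρ i : ℝ))
              * (∑ i, b i ^ (2 / 3 : ℝ) / s i ^ (2 / 3 : ℝ)) ^ (3 / 2 : ℝ)
            + 3 * Real.sqrt (Real.log (1 / δ) / (2 * n))} := by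
  have hW : 1 ≤ width d m := (Fin.pos (am 0)).trans_le (le_width_left d m (Fin.last L))
  have hσc : ∀ i, Continuous (σ i) := fun i => (hσ i).continuous
  lift s to Fin L → ℝ≥0 using fun i => (hs i).le
  have hdev := one_sub_le_measureReal_integral_marginLoss_network_le hσc hγ
    (weightClass M (fun i => s i) b) (μ := μ) hn hδ hδ1
  refine hdev.trans (measureReal_mono (Set.ofPred_subset_ofPred.2 fun S hS hB A hAs hAM => ?_))
  have hA : A ∈ weightClass M (fun i => s i) b := fun i => ⟨hAs i, hAM i⟩
  have hrad := empRademacher_marginLoss_network_le hn hσ hσ0 (fun i => NNReal.coe_pos.1 (hs i))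
    ⟨A, hA⟩ hγ hW hB
  calc errorProb μ am (network σ A) ≤ ∫ p, marginLoss γ (network σ A) p ∂μ :=
        errorProb_le_integral_marginLoss hγ ham
          ((continuous_network hσc).comp (Continuous.prodMk_right A))
    _ ≤ empRampRisk γ (network σ A) S + 2 * empRademacher
          (fun A : weightClass M (fun i => s i) b => marginLoss γ (network σ A)) S / n +
          3 * √(Real.log (1 / δ) / (2 * n)) := hS ⟨A, hA⟩
    _ ≤ empRampRisk γ (network σ A) S + 2 * (4 + 36 * B * Real.log (2 * width d m) * Real.log n /
          γ * spectralComplexity ρ (fun i => s i) b) / n +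
          3 * √(Real.log (1 / δ) / (2 * n)) := by
        gcongr
        linarith
    _ = _ := by
        rw [spectralComplexity]
        ring
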